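/- Let $U\subseteq\mathbb R^2$ be open; all coefficients below are smooth ($C^\infty$) functions of $(x,y)\in U$, and subscripts $x,y$ on them denote partial derivatives. Consider the fourth-order ODE, quadratic in $y''$, $$y''''+(Q_1y'-Q_0)y''^2-(R_4y'^4-R_3y'^3+R_2y'^2-R_1y'+R_0)y''-(S_6y'^6-S_5y'^5+S_4y'^4-S_3y'^3+S_2y'^2-S_1y'+S_0)=0\qquad(\mathrm F)$$ and the second-order (root) equation $$y''+c\,y'^3-g\,y'^2+h\,y'-d=0.\qquad(\mathrm E)$$ (1) (F) is obtained from (E) by differentiating (E) twice with respect to $x$ and eliminating $y'''$ by means of the once differentiated equation if and only if the following three conditions hold on $U$. (a) Identification of $c,g,h$: $c=Q_1/6$, $g=Q_0/2$ and $Q_1h=R_2-Q_0^2+Q_{1x}-\tfrac52Q_{0y}$ (so $h=(R_2-Q_0^2+Q_{1x}-\tfrac52Q_{0y})/Q_1$ wherever $Q_1\ne0$). (b) Integral for $d$: $d=\int(R_0-h^2+2h_x)\,dy+k(x)$, i.e. $d(x,y_2)-d(x,y_1)=\int_{y_1}^{y_2}(R_0-h^2+2h_x)(x,t)\,dt$ whenever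 the segment from $(x,y_1)$ to $(x,y_2)$ lies in $U$. (c) Constraints: $$R_4=\tfrac14Q_1^2,\quad R_3=Q_1Q_0+\tfrac76Q_{1y},\quad R_1=2Q_0h+3h_y-2Q_{0x},\quad S_6=\tfrac1{12}Q_1Q_{1y},$$ $$S_5=-\tfrac1{12}Q_1Q_{1x}+\tfrac16Q_0Q_{1y}+\tfrac14Q_1Q_{0y}+\tfrac16Q_{1yy},$$ $$S_4=-\tfrac16Q_0Q_{1x}+\tfrac16hQ_{1y}-\tfrac14Q_1Q_{0x}+\tfrac12Q_0Q_{0y}+\tfrac12Q_1h_y-\tfrac13Q_{1xy}+\tfrac12Q_{0yy},$$ $$S_3=\tfrac12Q_1(R_0-h^2+h_x)-\tfrac16hQ_{1x}-\tfrac12Q_0Q_{0x}+\tfrac12hQ_{0y}+Q_0h_y+\tfrac16Q_{1xx}-Q_{0xy}+h_{yy},$$ $$S_2=-\tfrac12Q_1d_x+Q_0(R_0-h^2+h_x)-hh_y-\tfrac12hQ_{0x}+R_{0y}+\tfrac12Q_{0xx},$$ $$S_1=h(R_0-h^2+5h_x)-2R_{0x}-Q_0d_x-3h_{xx},\qquad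 S_0=d_{xx}-hd_x.$$ (2) Suppose that (a), (b), (c) and the Lie–Tresse criteria $$3(ch)_x+3dc_y+6cd_y-2gg_x-gh_y-3c_{xx}-2g_{xy}-h_{yy}=0,$$ $$3(dg)_y+3cd_x+6dc_x-2hh_y-hg_x-3d_{yy}-2h_{xy}-g_{xx}=0$$ hold on $U$. Then (F) is conditionally linearizable with root equation (E): every solution of (E) is a solution of (F), and near every point of $U$ a smooth invertible point transformation $(x,y)\mapsto(X,Y)$ takes (E) to the linear equation $d^2Y/dX^2=0$. Moreover the Christoffel symbols are consistent with a metric: near every point of $U$ there are smooth $a,b,e,f$ with $h=a-2e$, $g=f-2b$ such that $\Gamma^1_{11}=-a$, $\Gamma^1_{12}=-b$, $\Gamma^1_{22}=-c$, $\Gamma^2_{11}=-d$, $\Gamma^2_{12}=-e$, $\Gamma^2_{22}=-f$ are the Christoffel symbols of a smooth nondegenerate flat metric $p\,dx^2+2q\,dx\,dy+r\,dy^2$. (3) If $Q_0$ and $Q_1$ do not both vanish identically on $U$, then the left-hand side of (F) is not a total derivative, i.e. it is not of the form $\frac{d}{dx}G(x,y,y',y'',y''')$ with $G$ of class $C^1$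 on the space of 3-jets over $U$. -/

import Mathlib

open scoped ContDiff

noncomputable section

namespace CondLin

/-- Partial derivative with respect to the first variable `x`. -/
def dx (f : ℝ × ℝ → ℝ) (z : ℝ × ℝ) : ℝ := deriv (fun t => f (t, z.2)) z.1

/-- Partial derivative with respect to the second variable `y`. -/
def dy (f : ℝ × ℝ → ℝ) (z : ℝ × ℝ) : ℝ := deriv (fun t => f (z.1, t)) z.2

/-- The coefficients of a root equation `y'' + c y'^3 - g y'^2 + h y' - d = 0`. -/
structure RootODE where
  c : ℝ × ℝ → ℝ
  g : ℝ × ℝ → ℝ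
  h : ℝ × ℝ → ℝ
  d : ℝ × ℝ → ℝ

/-- The coefficients of the fourth-order equation, quadratic in `y''`,
`y'''' + (Q₁ y' - Q₀) y''^2 - (R₄ y'^4 - R₃ y'^3 + R₂ y'^2 - R₁ y' + R₀) y''
  - (S₆ y'^6 - S₅ y'^5 + S₄ y'^4 - S₃ y'^3 + S₂ y'^2 - S₁ y' + S₀) = 0`. -/
structure QuadODE where
  Q0 : ℝ × ℝ → ℝ
  Q1 : ℝ × ℝ → ℝ
  R0 : ℝ × ℝ → ℝ
  R1 : ℝ × ℝ → ℝ
  R2 : ℝ × ℝ → ℝ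
  R3 : ℝ × ℝ → ℝ
  R4 : ℝ × ℝ → ℝ
  S0 : ℝ × ℝ → ℝ
  S1 : ℝ × ℝ → ℝ
  S2 : ℝ × ℝ → ℝ
  S3 : ℝ × ℝ → ℝ
  S4 : ℝ × ℝ → ℝ
  S5 : ℝ × ℝ → ℝ
  S6 : ℝ × ℝ → ℝ

/-- The coefficients of the root equation are smooth on `U`. -/
def RootODE.SmoothOn (E : RootODE) (U : Set (ℝ × ℝ)) : Prop :=
  ContDiffOn ℝ ∞ E.c U ∧ ContDiffOn ℝ ∞ E.g U ∧ ContDiffOn ℝ ∞ E.h U ∧ ContDiffOn ℝ ∞ E.d U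

/-- The coefficients of the fourth-order equation are smooth on `U`. -/
def QuadODE.SmoothOn (F : QuadODE) (U : Set (ℝ × ℝ)) : Prop :=
  (ContDiffOn ℝ ∞ F.Q0 U ∧ ContDiffOn ℝ ∞ F.Q1 U) ∧
  (ContDiffOn ℝ ∞ F.R0 U ∧ ContDiffOn ℝ ∞ F.R1 U ∧ ContDiffOn ℝ ∞ F.R2 U ∧
    ContDiffOn ℝ ∞ F.R3 U ∧ ContDiffOn ℝ ∞ F.R4 U) ∧
  (ContDiffOn ℝ ∞ F.S0 U ∧ ContDiffOn ℝ ∞ F.S1 U ∧ ContDiffOn ℝ ∞ F.S2 U ∧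
    ContDiffOn ℝ ∞ F.S3 U ∧ ContDiffOn ℝ ∞ F.S4 U ∧ ContDiffOn ℝ ∞ F.S5 U ∧
    ContDiffOn ℝ ∞ F.S6 U)

/-- The left-hand side of the root equation along the curve `x ↦ (x, y x)`. -/
def RootODE.lhs (E : RootODE) (y : ℝ → ℝ) (x : ℝ) : ℝ :=
  iteratedDeriv 2 y x + E.c (x, y x) * deriv y x ^ 3 - E.g (x, y x) * deriv y x ^ 2
    + E.h (x, y x) * deriv y x - E.d (x, y x)

/-- The left-hand side of the fourth-order equation along the curve `x ↦ (x, y x)`. -/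
def QuadODE.lhs (F : QuadODE) (y : ℝ → ℝ) (x : ℝ) : ℝ :=
  iteratedDeriv 4 y x
    + (F.Q1 (x, y x) * deriv y x - F.Q0 (x, y x)) * iteratedDeriv 2 y x ^ 2
    - (F.R4 (x, y x) * deriv y x ^ 4 - F.R3 (x, y x) * deriv y x ^ 3
        + F.R2 (x, y x) * deriv y x ^ 2 - F.R1 (x, y x) * deriv y x + F.R0 (x, y x))
      * iteratedDeriv 2 y x
    - (F.S6 (x, y x) * deriv y x ^ 6 - F.S5 (x, y x) * deriv y x ^ 5
        + F.S4 (x, y x) * deriv y x ^ 4 - F.S3 (x, y x) * deriv y x ^ 3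
        + F.S2 (x, y x) * deriv y x ^ 2 - F.S1 (x, y x) * deriv y x + F.S0 (x, y x))

/-- `y` is a solution on the open set `I`, with graph in `U`, of the root equation. -/
def RootODE.IsSolution (U : Set (ℝ × ℝ)) (E : RootODE) (I : Set ℝ) (y : ℝ → ℝ) : Prop :=
  IsOpen I ∧ ContDiffOn ℝ 2 y I ∧ (∀ x ∈ I, (x, y x) ∈ U) ∧ ∀ x ∈ I, E.lhs y x = 0

/-- `y` is a solution on the open set `I`, with graph in `U`, of the fourth-order equation. -/
def QuadODE.IsSolution (U : Set (ℝ × ℝ)) (F : QuadODE) (I : Set ℝ) (y : ℝ → ℝ) : Prop :=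
  IsOpen I ∧ ContDiffOn ℝ 4 y I ∧ (∀ x ∈ I, (x, y x) ∈ U) ∧ ∀ x ∈ I, F.lhs y x = 0

/-- The fourth-order equation is obtained from the root equation by differentiating it twice and
eliminating `y'''` with the help of the once differentiated equation. Since the left-hand side of
the fourth-order equation does not contain `y'''`, this says that it agrees with the second total
derivative of the left-hand side of the root equation at every jet at which the first total
derivative vanishes. -/
def ArisesFrom (U : Set (ℝ × ℝ)) (F : QuadODE) (E : RootODE) : Prop :=
  ∀ y : ℝ → ℝ, ContDiff ℝ ∞ y → ∀ x : ℝ, (x, y x) ∈ U →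
    deriv (E.lhs y) x = 0 → F.lhs y x = iteratedDeriv 2 (E.lhs y) x

/-- The left-hand side of the fourth-order equation is a total derivative: it is the derivative of
`G(x, y, y', y'', y''')` for a `C¹` function `G` on the space of 3-jets over `U`. -/
def IsTotalDerivative (U : Set (ℝ × ℝ)) (F : QuadODE) : Prop :=
  ∃ G : (ℝ × ℝ) × ℝ × ℝ × ℝ → ℝ,
    ContDiffOn ℝ 1 G {j | j.1 ∈ U} ∧
    ∀ y : ℝ → ℝ, ContDiff ℝ ∞ y → ∀ x : ℝ, (x, y x) ∈ U →
      F.lhs y x =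
        deriv (fun t => G ((t, y t), deriv y t, iteratedDeriv 2 y t, iteratedDeriv 3 y t)) x

/-- The algebraic identification of `c`, `g`, `h`. The last equation is
`h = (R₂ - Q₀^2 + Q₁ₓ - (5/2) Q₀ᵧ) / Q₁` wherever `Q₁ ≠ 0`. -/
def Identification (U : Set (ℝ × ℝ)) (F : QuadODE) (E : RootODE) : Prop :=
  ∀ z ∈ U, E.c z = F.Q1 z / 6 ∧ E.g z = F.Q0 z / 2 ∧
    F.Q1 z * E.h z = F.R2 z - F.Q0 z ^ 2 + dx F.Q1 z - 5 * dy F.Q0 z / 2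

/-- `d = ∫ (R₀ - h^2 + 2 hₓ) dy + k(x)`, on every vertical segment contained in `U`. -/
def IntegralFormula (U : Set (ℝ × ℝ)) (F : QuadODE) (E : RootODE) : Prop :=
  ∀ x y₁ y₂ : ℝ, (∀ t ∈ Set.uIcc y₁ y₂, (x, t) ∈ U) →
    E.d (x, y₂) =
      (∫ t in y₁..y₂, (F.R0 (x, t) - E.h (x, t) ^ 2 + 2 * dx E.h (x, t))) + E.d (x, y₁)

/-- The constraints on the remaining coefficients. -/
def Constraints (U : Set (ℝ × ℝ)) (F : QuadODE) (E : RootODE) : Prop :=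
  ∀ z ∈ U,
    F.R4 z = F.Q1 z ^ 2 / 4 ∧
    F.R3 z = F.Q1 z * F.Q0 z + 7 * dy F.Q1 z / 6 ∧
    F.R1 z = 2 * F.Q0 z * E.h z + 3 * dy E.h z - 2 * dx F.Q0 z ∧
    F.S6 z = F.Q1 z * dy F.Q1 z / 12 ∧
    F.S5 z = -(F.Q1 z * dx F.Q1 z) / 12 + F.Q0 z * dy F.Q1 z / 6 + F.Q1 z * dy F.Q0 z / 4
      + dy (dy F.Q1) z / 6 ∧
    F.S4 z = -(F.Q0 z * dx F.Q1 z) / 6 + E.h z * dy F.Q1 z / 6 - F.Q1 z * dx F.Q0 z / 4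
      + F.Q0 z * dy F.Q0 z / 2 + F.Q1 z * dy E.h z / 2 - dy (dx F.Q1) z / 3
      + dy (dy F.Q0) z / 2 ∧
    F.S3 z = F.Q1 z * (F.R0 z - E.h z ^ 2 + dx E.h z) / 2 - E.h z * dx F.Q1 z / 6
      - F.Q0 z * dx F.Q0 z / 2 + E.h z * dy F.Q0 z / 2 + F.Q0 z * dy E.h z
      + dx (dx F.Q1) z / 6 - dy (dx F.Q0) z + dy (dy E.h) z ∧
    F.S2 z = -(F.Q1 z * dx E.d z) / 2 + F.Q0 z * (F.R0 z - E.h z ^ 2 + dx E.h z)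
      - E.h z * dy E.h z - E.h z * dx F.Q0 z / 2 + dy F.R0 z + dx (dx F.Q0) z / 2 ∧
    F.S1 z = E.h z * (F.R0 z - E.h z ^ 2 + 5 * dx E.h z) - 2 * dx F.R0 z - F.Q0 z * dx E.d z
      - 3 * dx (dx E.h) z ∧
    F.S0 z = dx (dx E.d) z - E.h z * dx E.d z

/-- The Lie–Tresse linearizability criteria for the root equation. -/
def LieTresse (U : Set (ℝ × ℝ)) (E : RootODE) : Prop :=
  ∀ z ∈ U,
    3 * dx (fun w => E.c w * E.h w) z + 3 * E.d z * dy E.c z + 6 * E.c z * dy E.d z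
      - 2 * E.g z * dx E.g z - E.g z * dy E.h z
      - 3 * dx (dx E.c) z - 2 * dy (dx E.g) z - dy (dy E.h) z = 0 ∧
    3 * dy (fun w => E.d w * E.g w) z + 3 * E.c z * dx E.d z + 6 * E.d z * dx E.c z
      - 2 * E.h z * dy E.h z - E.h z * dx E.g z
      - 3 * dy (dy E.d) z - 2 * dy (dx E.h) z - dx (dx E.g) z = 0

/-- The second derivative `d²Y/dX²` of the image of the curve `x ↦ (x, y x)` under the change of
variables `(x, y) ↦ (X, Y)`; it is meaningful where `dX/dx ≠ 0`. -/
def transformedSecondDeriv (X Y : ℝ × ℝ → ℝ) (y : ℝ → ℝ) (x : ℝ) : ℝ :=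
  deriv (fun t => deriv (fun s => Y (s, y s)) t / deriv (fun s => X (s, y s)) t) x
    / deriv (fun s => X (s, y s)) x

/-- The root equation is linearizable on `U`: near every point a smooth invertible point
transformation `(x, y) ↦ (X, Y)` takes it to the linear equation `d²Y/dX² = 0`. -/
def RootODE.Linearizable (U : Set (ℝ × ℝ)) (E : RootODE) : Prop :=
  ∀ z₀ ∈ U, ∃ (V : Set (ℝ × ℝ)) (X Y : ℝ × ℝ → ℝ),
    IsOpen V ∧ z₀ ∈ V ∧ V ⊆ U ∧
    ContDiffOn ℝ ∞ X V ∧ ContDiffOn ℝ ∞ Y V ∧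
    Set.InjOn (fun z => (X z, Y z)) V ∧
    (∀ z ∈ V, dx X z * dy Y z - dy X z * dx Y z ≠ 0) ∧
    ∀ y : ℝ → ℝ, ContDiff ℝ ∞ y → ∀ x : ℝ, (x, y x) ∈ V →
      deriv (fun s => X (s, y s)) x ≠ 0 →
      (E.lhs y x = 0 ↔ transformedSecondDeriv X Y y x = 0)

/-- The fourth-order equation is conditionally linearizable, subject to the root equation:
every solution of the root equation solves it, and the root equation is linearizable. -/
def ConditionallyLinearizable (U : Set (ℝ × ℝ)) (F : QuadODE) (E : RootODE) : Prop :=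
  (∀ (I : Set ℝ) (y : ℝ → ℝ), E.IsSolution U I y → F.IsSolution U I y) ∧ E.Linearizable U

/-- Vanishing on `V` of the curvature of the connection with Christoffel symbols
`Γ¹₁₁ = -a, Γ¹₁₂ = -b, Γ¹₂₂ = -c, Γ²₁₁ = -d, Γ²₁₂ = -e, Γ²₂₂ = -f`. -/
def Flat (V : Set (ℝ × ℝ)) (a b c d e f : ℝ × ℝ → ℝ) : Prop :=
  ∀ z ∈ V,
    dy a z - dx b z + b z * e z - c z * d z = 0 ∧
    dy b z - dx c z + (a z * c z - b z ^ 2) + (b z * f z - c z * e z) = 0 ∧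
    dy d z - dx e z - (a z * e z - b z * d z) - (d z * f z - e z ^ 2) = 0 ∧
    dx (fun w => b w + f w) z = dy (fun w => a w + e w) z

/-- On `V`, the same Christoffel symbols are those of the nondegenerate metric
`p dx² + 2 q dx dy + r dy²`. -/
def MetricCompatible (V : Set (ℝ × ℝ)) (a b c d e f p q r : ℝ × ℝ → ℝ) : Prop :=
  ∀ z ∈ V,
    p z * r z - q z ^ 2 ≠ 0 ∧
    dx p z = -2 * (a z * p z + d z * q z) ∧
    dx q z = -(b z * p z) - (a z + e z) * q z - d z * r z ∧
    dx r z = -2 * (b z * q z + e z * r z) ∧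
    dy p z = -2 * (b z * p z + e z * q z) ∧
    dy q z = -(c z * p z) - (b z + f z) * q z - e z * r z ∧
    dy r z = -2 * (c z * q z + f z * r z)

/-- Near every point of `U` the coefficients `c, d` of the root equation can be completed by
`a, b, e, f` with `h = a - 2 e`, `g = f - 2 b` to the Christoffel symbols of a flat metric. -/
def MetricConsistent (U : Set (ℝ × ℝ)) (E : RootODE) : Prop :=
  ∀ z₀ ∈ U, ∃ (V : Set (ℝ × ℝ)) (a b e f p q r : ℝ × ℝ → ℝ),
    IsOpen V ∧ z₀ ∈ V ∧ V ⊆ U ∧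
    (ContDiffOn ℝ ∞ a V ∧ ContDiffOn ℝ ∞ b V ∧ ContDiffOn ℝ ∞ e V ∧ ContDiffOn ℝ ∞ f V) ∧
    (ContDiffOn ℝ ∞ p V ∧ ContDiffOn ℝ ∞ q V ∧ ContDiffOn ℝ ∞ r V) ∧
    (∀ z ∈ V, E.h z = a z - 2 * e z ∧ E.g z = f z - 2 * b z) ∧
    Flat V a b E.c E.d e f ∧
    MetricCompatible V a b E.c E.d e f p q r

end CondLin

end

/-! (1) Smooth curves realize every jet, so `ArisesFrom` is an identity in the jet variables. The
first total derivative of (E) is y''' plus terms without y''', so y''' can be eliminated from the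
second one. What remains is a polynomial identity, of degree 6 in y' and 2 in y'', and comparing
coefficients gives `CoefficientRelations` (`jets_iff_coefficientRelations`). Conditions (a), (b),
(c) are these relations rewritten through Q₁ = 6c, Q₀ = 2g and R₀ = h² + d_y - 2h_x, the last of
which is (b) differentiated in y (`coefficientRelations_iff`).

(2) A solution of (E) makes both total derivatives vanish, hence solves (F). Linearizability is
projective geometry: the solutions of (E) are the unparametrized geodesics of every connection with
h = a - 2e and g = f - 2b. The trace-free one among them (a + e = 0, b + f = 0) has a symmetric
Ricci tensor, and the system ∇²u = -Ric u, which is `IsFrameOn`, is integrable thanks to the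
Lie–Tresse criteria. It can therefore be solved near each point with arbitrary initial values of u,
u_x, u_y. If u does not vanish, the projective change of the connection by d log u is flat, and the
quotients X = u₁/u and Y = u₂/u are affine coordinates for it. In these coordinates geodesics are
straight lines, so (E) becomes d²Y/dX² = 0, and dX² + dY² is a compatible metric. Local solvability
is the Frobenius theorem for linear total differential equations
(`exists_total_differential_solution`), obtained from ordinary equations in x and then in y.

(3) If (F) is the total derivative of G, the coefficient 1 of y'''' forces G = y''' + (a function of
lower jets). Absence of y''' then makes that function independent of y'', so its total derivative is
affine in y'', and the term (Q₁y' - Q₀)y''² must vanish. -/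

noncomputable section

namespace CondLin

/-! ### Linear total differential equations in two variables -/

section TotalDifferential

variable {E : Type*} [NormedAddCommGroup E] [NormedSpace ℝ E]

open Set in
/-- A Grönwall type estimate, on both sides of the initial time, on a short interval. -/
theorem norm_le_of_norm_deriv_le {f f' : ℝ → E} {t₀ δ K ε : ℝ} (hδ : 0 ≤ δ) (hε : 0 ≤ ε)
    (hK : 0 ≤ K) (hKδ : K * δ ≤ 1 / 2)
    (hf : ∀ t ∈ Icc (t₀ - δ) (t₀ + δ), HasDerivWithinAt f (f' t) (Icc (t₀ - δ) (t₀ + δ)) t)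
    (bound : ∀ t ∈ Icc (t₀ - δ) (t₀ + δ), ‖f' t‖ ≤ K * ‖f t‖ + ε) :
    ∀ t ∈ Icc (t₀ - δ) (t₀ + δ), ‖f t‖ ≤ 2 * ‖f t₀‖ + 2 * (ε * δ) := by
  have h0 : t₀ ∈ Icc (t₀ - δ) (t₀ + δ) := ⟨by linarith, by linarith⟩
  have hc : ContinuousOn (fun t => ‖f t‖) (Icc (t₀ - δ) (t₀ + δ)) :=
    fun t ht => (hf t ht).continuousWithinAt.norm
  -- At a point `s` where ‖f‖ is largest the mean value inequality gives ‖f s‖ ≤ ‖f t₀‖ + (K‖f s‖ +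
  -- ε)δ, and Kδ ≤ 1/2 lets the left side absorb K‖f s‖δ.
  obtain ⟨s, hs, hmax⟩ := isCompact_Icc.exists_isMaxOn ⟨t₀, h0⟩ hc
  have hmax' : ∀ t ∈ Icc (t₀ - δ) (t₀ + δ), ‖f t‖ ≤ ‖f s‖ := fun t ht => hmax ht
  have hd : ∀ t ∈ Icc (t₀ - δ) (t₀ + δ), ‖f' t‖ ≤ K * ‖f s‖ + ε := fun t ht =>
    (bound t ht).trans (by gcongr; exact hmax' t ht)
  have hmv := (convex_Icc (t₀ - δ) (t₀ + δ)).norm_image_sub_le_of_norm_hasDerivWithin_le hf hd h0 hs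
  have hst : ‖s - t₀‖ ≤ δ := by
    rw [Real.norm_eq_abs, abs_le]; constructor <;> linarith [hs.1, hs.2]
  have h1 : ‖f s‖ ≤ ‖f t₀‖ + ‖f s - f t₀‖ := by
    simpa using norm_add_le (f t₀) (f s - f t₀)
  have h2 : (K * ‖f s‖ + ε) * ‖s - t₀‖ ≤ (K * ‖f s‖ + ε) * δ := by
    have := norm_nonneg (f s)
    gcongr
  have h3 : K * δ * ‖f s‖ ≤ 1 / 2 * ‖f s‖ := by gcongr
  intro t ht
  have h4 := hmax' t ht
  nlinarith

open Set in
/-- A linear differential equation with continuous bounded coefficients has a solution on an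
interval whose length depends only on the bound. -/
theorem exists_linear_ode_solution [CompleteSpace E] {C : ℝ → E →L[ℝ] E} {t₀ δ M : ℝ} (hδ : 0 ≤ δ)
    (hM : 0 ≤ M) (hMδ : M * δ ≤ 1 / 2) (hC : ContinuousOn C (Icc (t₀ - δ) (t₀ + δ)))
    (hCM : ∀ t ∈ Icc (t₀ - δ) (t₀ + δ), ‖C t‖ ≤ M) (w : E) :
    ∃ α : ℝ → E, α t₀ = w ∧ ∀ t ∈ Icc (t₀ - δ) (t₀ + δ),
      HasDerivWithinAt α (C t (α t)) (Icc (t₀ - δ) (t₀ + δ)) t := by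
  have h0 : t₀ ∈ Icc (t₀ - δ) (t₀ + δ) := ⟨by linarith, by linarith⟩
  lift M to NNReal using hM
  -- On the ball of radius ‖w‖ about w one has ‖x‖ ≤ 2‖w‖, so the speed is at most 2M‖w‖, and 2M‖w‖δ
  -- ≤ ‖w‖ keeps the solution in the ball on the whole interval.
  have hPL : IsPicardLindelof (fun t x => C t x) (⟨t₀, h0⟩ : Icc (t₀ - δ) (t₀ + δ)) w ‖w‖₊ 0
      (2 * M * ‖w‖₊) M := by
    refine ⟨fun t ht => ?_, fun x _ => hC.clm_apply continuousOn_const, fun t ht x hx => ?_, ?_⟩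
    · refine (((C t).lipschitz).weaken ?_).lipschitzOnWith
      exact hCM t ht
    · have hx' : ‖x‖ ≤ 2 * ‖w‖ := by
        have h1 : ‖x - w‖ ≤ ‖w‖ := by simpa [dist_eq_norm] using hx
        have h2 : ‖x‖ ≤ ‖w‖ + ‖x - w‖ := by simpa using norm_add_le w (x - w)
        linarith
      calc ‖C t x‖ ≤ ‖C t‖ * ‖x‖ := (C t).le_opNorm x
        _ ≤ M * (2 * ‖w‖) := by
          have := hCM t ht
          gcongr
        _ = _ := by push_cast; ring
    · have : max (t₀ + δ - t₀) (t₀ - (t₀ - δ)) = δ := by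
        rw [max_eq_left] <;> linarith
      simp only [this]
      push_cast
      nlinarith [norm_nonneg w]
  obtain ⟨α, h1, h2⟩ := hPL.exists_eq_forall_mem_Icc_hasDerivWithinAt₀
  exact ⟨α, h1, h2⟩

open Set Asymptotics in
/-- Solvability of `W_x = A W`, `W_y = B W` on a closed square, with quantitative hypotheses. -/
theorem exists_total_differential_on_square [CompleteSpace E] {A B Ay Bx : ℝ → ℝ → E →L[ℝ] E}
    {x₀ y₀ δ M : ℝ} (hδ : 0 ≤ δ) (hM : 0 ≤ M) (hMδ : M * δ ≤ 1 / 2)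
    (hAc : ContinuousOn (fun x => A x y₀) (Icc (x₀ - δ) (x₀ + δ)))
    (hBc : ∀ x ∈ Icc (x₀ - δ) (x₀ + δ), ContinuousOn (B x) (Icc (y₀ - δ) (y₀ + δ)))
    (hA : ∀ x ∈ Icc (x₀ - δ) (x₀ + δ), ∀ y ∈ Icc (y₀ - δ) (y₀ + δ), ‖A x y‖ ≤ M)
    (hB : ∀ x ∈ Icc (x₀ - δ) (x₀ + δ), ∀ y ∈ Icc (y₀ - δ) (y₀ + δ), ‖B x y‖ ≤ M)
    (hAy : ∀ x ∈ Icc (x₀ - δ) (x₀ + δ), ∀ y ∈ Icc (y₀ - δ) (y₀ + δ),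
      HasDerivWithinAt (A x) (Ay x y) (Icc (y₀ - δ) (y₀ + δ)) y)
    (hB1 : ∀ x ∈ Icc (x₀ - δ) (x₀ + δ), ∀ x' ∈ Icc (x₀ - δ) (x₀ + δ),
      ∀ y ∈ Icc (y₀ - δ) (y₀ + δ), ‖B x' y - B x y‖ ≤ M * ‖x' - x‖)
    (hB2 : ∀ x ∈ Icc (x₀ - δ) (x₀ + δ), ∀ x' ∈ Icc (x₀ - δ) (x₀ + δ),
      ∀ y ∈ Icc (y₀ - δ) (y₀ + δ), ‖B x' y - B x y - (x' - x) • Bx x y‖ ≤ M * ‖x' - x‖ ^ 2)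
    (hint : ∀ x ∈ Icc (x₀ - δ) (x₀ + δ), ∀ y ∈ Icc (y₀ - δ) (y₀ + δ), ∀ w,
      Ay x y w + A x y (B x y w) = Bx x y w + B x y (A x y w))
    (w₀ : E) :
    ∃ W : ℝ → ℝ → E, W x₀ y₀ = w₀ ∧
      ∀ x ∈ Icc (x₀ - δ) (x₀ + δ), ∀ y ∈ Icc (y₀ - δ) (y₀ + δ),
        HasDerivWithinAt (fun s => W s y) (A x y (W x y)) (Icc (x₀ - δ) (x₀ + δ)) x ∧
        HasDerivWithinAt (W x) (B x y (W x y)) (Icc (y₀ - δ) (y₀ + δ)) y ∧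
        ‖W x y‖ ≤ 4 * ‖w₀‖ := by
  have hx0 : x₀ ∈ Icc (x₀ - δ) (x₀ + δ) := ⟨by linarith, by linarith⟩
  have hy0 : y₀ ∈ Icc (y₀ - δ) (y₀ + δ) := ⟨by linarith, by linarith⟩
  -- `m` solves the equation along y = y₀, and `W x` continues it vertically from `m x`. The
  -- equation in y then holds by construction; only the one in x needs an argument.
  obtain ⟨m, hm0, hm⟩ := exists_linear_ode_solution hδ hM hMδ hAc (fun x hx => hA x hx y₀ hy0) w₀
  have hmb : ∀ x ∈ Icc (x₀ - δ) (x₀ + δ), ‖m x‖ ≤ 2 * ‖w₀‖ := by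
    intro x hx
    have := norm_le_of_norm_deriv_le hδ le_rfl hM hMδ hm (fun t ht => by
      have := hA t ht y₀ hy0
      calc ‖A t y₀ (m t)‖ ≤ ‖A t y₀‖ * ‖m t‖ := (A t y₀).le_opNorm _
        _ ≤ M * ‖m t‖ + 0 := by rw [add_zero]; gcongr) x hx
    simpa [hm0] using this
  choose! W hW0 hW using fun x (hx : x ∈ Icc (x₀ - δ) (x₀ + δ)) =>
    exists_linear_ode_solution hδ hM hMδ (hBc x hx) (fun y hy => hB x hx y hy) (m x)
  have hWb : ∀ x ∈ Icc (x₀ - δ) (x₀ + δ), ∀ y ∈ Icc (y₀ - δ) (y₀ + δ), ‖W x y‖ ≤ 4 * ‖w₀‖ := by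
    intro x hx y hy
    have := norm_le_of_norm_deriv_le hδ le_rfl hM hMδ (hW x hx) (fun t ht => by
      have := hB x hx t ht
      calc ‖B x t (W x t)‖ ≤ ‖B x t‖ * ‖W x t‖ := (B x t).le_opNorm _
        _ ≤ M * ‖W x t‖ + 0 := by rw [add_zero]; gcongr) y hy
    rw [hW0 x hx] at this
    linarith [hmb x hx]
  refine ⟨W, by rw [hW0 x₀ hx0, hm0], fun x hx y hy => ⟨?_, hW x hx y hy, hWb x hx y hy⟩⟩
  set N := 4 * ‖w₀‖ with hN
  have hN0 : 0 ≤ N := by positivity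
  -- By the integrability condition the error D(t) = W(x',t) - W(x,t) - (x' - x) A W(x,t) satisfies
  -- D' = B(x',t) D + O(|x' - x|²). It is thus controlled by its value at y₀, which is o(x' - x)
  -- because `m` solves the equation in x.
  have key : ∀ x' ∈ Icc (x₀ - δ) (x₀ + δ),
      ‖W x' y - W x y - (x' - x) • A x y (W x y)‖ ≤
        2 * ‖m x' - m x - (x' - x) • A x y₀ (m x)‖ + 2 * ((M * N + M * M * N) * ‖x' - x‖ ^ 2 * δ) := by
    intro x' hx'
    have hder : ∀ t ∈ Icc (y₀ - δ) (y₀ + δ), HasDerivWithinAt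
        (fun t => W x' t - W x t - (x' - x) • A x t (W x t))
        (B x' t (W x' t) - B x t (W x t) -
          (x' - x) • (Ay x t (W x t) + A x t (B x t (W x t)))) (Icc (y₀ - δ) (y₀ + δ)) t := by
      intro t ht
      exact ((hW x' hx' t ht).sub (hW x hx t ht)).sub
        (((hAy x hx t ht).clm_apply (hW x hx t ht)).const_smul (x' - x))
    have hb := norm_le_of_norm_deriv_le hδ
      (ε := (M * N + M * M * N) * ‖x' - x‖ ^ 2) (by positivity) hM hMδ hder (fun t ht => by
        have e : B x' t (W x' t) - B x t (W x t) -
            (x' - x) • (Ay x t (W x t) + A x t (B x t (W x t))) =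
            B x' t (W x' t - W x t - (x' - x) • A x t (W x t)) +
              (B x' t - B x t - (x' - x) • Bx x t) (W x t) +
              (x' - x) • (B x' t - B x t) (A x t (W x t)) := by
          rw [hint x hx t ht]
          simp only [map_sub, map_smul, sub_apply,
            smul_apply, smul_sub, smul_add]
          abel
        rw [e]
        have b1 := hB x' hx' t ht
        have b2 := hB2 x hx x' hx' t ht
        have b3 := hB1 x hx x' hx' t ht
        have b4 := hA x hx t ht
        have b5 := hWb x hx t ht
        have c1 : ‖B x' t (W x' t - W x t - (x' - x) • A x t (W x t))‖ ≤
            M * ‖W x' t - W x t - (x' - x) • A x t (W x t)‖ :=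
          ((B x' t).le_opNorm _).trans (by gcongr)
        have c2 : ‖(B x' t - B x t - (x' - x) • Bx x t) (W x t)‖ ≤ M * ‖x' - x‖ ^ 2 * N :=
          (ContinuousLinearMap.le_opNorm _ _).trans (by gcongr)
        have c4 : ‖A x t (W x t)‖ ≤ M * N := ((A x t).le_opNorm _).trans (by gcongr)
        have c3 : ‖(x' - x) • (B x' t - B x t) (A x t (W x t))‖ ≤
            ‖x' - x‖ * (M * ‖x' - x‖ * (M * N)) := by
          rw [norm_smul]
          gcongr
          exact (ContinuousLinearMap.le_opNorm _ _).trans (by gcongr)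
        refine (norm_add₃_le).trans ?_
        linarith [c1, c2, c3]) y hy
    simpa [hW0 x hx, hW0 x' hx'] using hb
  rw [hasDerivWithinAt_iff_isLittleO]
  have hmo := hasDerivWithinAt_iff_isLittleO.1 (hm x hx)
  have hsq : (fun x' => ‖x' - x‖ ^ 2) =o[nhdsWithin x (Icc (x₀ - δ) (x₀ + δ))] fun x' => x' - x := by
    have h1 : (fun x' : ℝ => x' - x) =o[nhdsWithin x (Icc (x₀ - δ) (x₀ + δ))] fun _ => (1 : ℝ) := by
      rw [isLittleO_one_iff]
      have : Filter.Tendsto (fun x' : ℝ => x' - x) (nhds x) (nhds (x - x)) :=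
        (continuous_id.sub continuous_const).tendsto x
      rw [sub_self] at this
      exact this.mono_left nhdsWithin_le_nhds
    have h2 := h1.norm_left.mul_isBigO
      ((isBigO_refl (fun x' : ℝ => x' - x) (nhdsWithin x (Icc (x₀ - δ) (x₀ + δ)))).norm_left)
    simpa [pow_two] using h2
  have hsum := (hmo.norm_left.const_mul_left 2).add
    (hsq.const_mul_left (2 * ((M * N + M * M * N) * δ)))
  refine IsBigO.trans_isLittleO ?_ hsum
  refine IsBigO.of_bound 1 ?_
  filter_upwards [self_mem_nhdsWithin] with x' hx'
  rw [one_mul]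
  refine (key x' hx').trans ((le_abs_self _).trans_eq' ?_)
  ring

open Set in
/-- A differentiable solution of a total differential equation with smooth coefficients is
smooth. -/
theorem contDiffOn_of_total_differential {A B : ℝ × ℝ → E →L[ℝ] E} {V : Set (ℝ × ℝ)}
    (hV : IsOpen V) (hA : ContDiffOn ℝ ∞ A V) (hB : ContDiffOn ℝ ∞ B V) {W : ℝ × ℝ → E}
    (hW : ∀ z ∈ V, HasFDerivAt W ((ContinuousLinearMap.fst ℝ ℝ ℝ).smulRight (A z (W z)) +
      (ContinuousLinearMap.snd ℝ ℝ ℝ).smulRight (B z (W z))) z) :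
    ContDiffOn ℝ ∞ W V := by
  rw [contDiffOn_infty]
  intro n
  induction n with
  | zero =>
    exact contDiffOn_zero.2 fun z hz => (hW z hz).continuousAt.continuousWithinAt
  | succ n ih =>
    -- The derivative of `W` is assembled from A z (W z) and B z (W z), hence is as smooth as `W` is
    -- already known to be; each induction step gains one order.
    push_cast
    rw [contDiffOn_succ_iff_fderiv_of_isOpen hV]
    refine ⟨fun z hz => (hW z hz).differentiableAt.differentiableWithinAt, by simp, ?_⟩
    have hn : (n : ℕ∞ω) ≤ ∞ := by exact_mod_cast le_top
    have h1 : ContDiffOn ℝ n (fun z => (ContinuousLinearMap.fst ℝ ℝ ℝ).smulRight (A z (W z)) +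
        (ContinuousLinearMap.snd ℝ ℝ ℝ).smulRight (B z (W z))) V :=
      (contDiffOn_const.smulRight ((hA.of_le hn).clm_apply ih)).add
        (contDiffOn_const.smulRight ((hB.of_le hn).clm_apply ih))
    exact h1.congr fun z hz => (hW z hz).fderiv

open Set in
/-- Local solvability of the total differential equation `W_x = A W`, `W_y = B W` with smooth
coefficients satisfying the integrability condition `A_y + A B = B_x + B A`. -/
theorem exists_total_differential_solution [CompleteSpace E] {A B : ℝ × ℝ → E →L[ℝ] E}
    {U : Set (ℝ × ℝ)} (hU : IsOpen U) (hA : ContDiffOn ℝ ∞ A U) (hB : ContDiffOn ℝ ∞ B U)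
    (hint : ∀ z ∈ U, ∀ w, fderiv ℝ A z (0, 1) w + A z (B z w) =
      fderiv ℝ B z (1, 0) w + B z (A z w))
    {z₀ : ℝ × ℝ} (hz₀ : z₀ ∈ U) (w₀ : E) :
    ∃ (V : Set (ℝ × ℝ)) (W : ℝ × ℝ → E), IsOpen V ∧ z₀ ∈ V ∧ V ⊆ U ∧ ContDiffOn ℝ ∞ W V ∧
      W z₀ = w₀ ∧ ∀ z ∈ V, HasFDerivAt W ((ContinuousLinearMap.fst ℝ ℝ ℝ).smulRight (A z (W z)) +
        (ContinuousLinearMap.snd ℝ ℝ ℝ).smulRight (B z (W z))) z := by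
  obtain ⟨x₀, y₀⟩ := z₀
  obtain ⟨ρ, hρ, hρU⟩ := Metric.nhds_basis_closedBall.mem_iff.1 (hU.mem_nhds hz₀)
  rw [← closedBall_prod_same, Real.closedBall_eq_Icc, Real.closedBall_eq_Icc] at hρU
  have hK : IsCompact (Icc (x₀ - ρ) (x₀ + ρ) ×ˢ Icc (y₀ - ρ) (y₀ + ρ)) :=
    isCompact_Icc.prod isCompact_Icc
  have hBx : ContDiffOn ℝ ∞ (fun z => fderiv ℝ B z (1, 0)) U :=
    (hB.fderiv_of_isOpen hU (by simp)).clm_apply contDiffOn_const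
  have hBxx : ContinuousOn (fun z => fderiv ℝ (fun z => fderiv ℝ B z (1, 0)) z (1, 0)) U :=
    ((hBx.continuousOn_fderiv_of_isOpen hU (by simp)).clm_apply continuousOn_const)
  obtain ⟨MA, hMA⟩ := hK.exists_bound_of_continuousOn (hA.continuousOn.mono hρU)
  obtain ⟨MB, hMB⟩ := hK.exists_bound_of_continuousOn (hB.continuousOn.mono hρU)
  obtain ⟨MBx, hMBx⟩ := hK.exists_bound_of_continuousOn (hBx.continuousOn.mono hρU)
  obtain ⟨MBxx, hMBxx⟩ := hK.exists_bound_of_continuousOn (hBxx.mono hρU)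
  obtain ⟨M, hM0, hM1, hM2, hM3, hM4⟩ : ∃ M : ℝ, 0 < M ∧ MA ≤ M ∧ MB ≤ M ∧ MBx ≤ M ∧ MBxx ≤ M := by
    refine ⟨1 + |MA| + |MB| + |MBx| + |MBxx|, ?_, ?_, ?_, ?_, ?_⟩
    · positivity
    all_goals
      have h1 := le_abs_self MA
      have h2 := le_abs_self MB
      have h3 := le_abs_self MBx
      have h4 := le_abs_self MBxx
      linarith [abs_nonneg MA, abs_nonneg MB, abs_nonneg MBx, abs_nonneg MBxx]
  obtain ⟨δ, hδ, hδρ, hMδ⟩ : ∃ δ : ℝ, 0 < δ ∧ δ ≤ ρ ∧ M * δ ≤ 1 / 2 := by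
    refine ⟨min ρ (1 / (2 * M)), lt_min hρ (by positivity), min_le_left _ _, ?_⟩
    calc M * min ρ (1 / (2 * M)) ≤ M * (1 / (2 * M)) := by gcongr; exact min_le_right _ _
      _ = 1 / 2 := by field_simp
  have hI : ∀ x ∈ Icc (x₀ - δ) (x₀ + δ), ∀ y ∈ Icc (y₀ - δ) (y₀ + δ),
      (x, y) ∈ Icc (x₀ - ρ) (x₀ + ρ) ×ˢ Icc (y₀ - ρ) (y₀ + ρ) := fun x hx y hy =>
    ⟨⟨by linarith [hx.1], by linarith [hx.2]⟩, ⟨by linarith [hy.1], by linarith [hy.2]⟩⟩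
  have hIU : ∀ x ∈ Icc (x₀ - δ) (x₀ + δ), ∀ y ∈ Icc (y₀ - δ) (y₀ + δ), (x, y) ∈ U :=
    fun x hx y hy => hρU (hI x hx y hy)
  have hd : ∀ {f : ℝ × ℝ → E →L[ℝ] E}, ContDiffOn ℝ ∞ f U → ∀ z ∈ U,
      HasFDerivAt f (fderiv ℝ f z) z := fun hf z hz =>
    ((hf.differentiableOn (by simp)).differentiableAt (hU.mem_nhds hz)).hasFDerivAt
  have hdx : ∀ {f : ℝ × ℝ → E →L[ℝ] E}, ContDiffOn ℝ ∞ f U → ∀ x y, (x, y) ∈ U →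
      HasDerivAt (fun s => f (s, y)) (fderiv ℝ f (x, y) (1, 0)) x := fun hf x y hz =>
    HasFDerivAt.comp_hasDerivAt (f := fun s : ℝ => (s, y)) x (hd hf _ hz)
      ((hasDerivAt_id x).prodMk (hasDerivAt_const x y))
  have hdy : ∀ {f : ℝ × ℝ → E →L[ℝ] E}, ContDiffOn ℝ ∞ f U → ∀ x y, (x, y) ∈ U →
      HasDerivAt (fun s => f (x, s)) (fderiv ℝ f (x, y) (0, 1)) y := fun hf x y hz =>
    HasFDerivAt.comp_hasDerivAt (f := fun s : ℝ => (x, s)) y (hd hf _ hz)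
      ((hasDerivAt_const y x).prodMk (hasDerivAt_id y))
  have lip : ∀ {f : ℝ × ℝ → E →L[ℝ] E}, ContDiffOn ℝ ∞ f U →
      (∀ z ∈ Icc (x₀ - ρ) (x₀ + ρ) ×ˢ Icc (y₀ - ρ) (y₀ + ρ), ‖fderiv ℝ f z (1, 0)‖ ≤ M) →
      ∀ x ∈ Icc (x₀ - δ) (x₀ + δ), ∀ x' ∈ Icc (x₀ - δ) (x₀ + δ), ∀ y ∈ Icc (y₀ - δ) (y₀ + δ),
      ‖f (x', y) - f (x, y)‖ ≤ M * ‖x' - x‖ := fun hf hfM x hx x' hx' y hy =>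
    (convex_Icc (x₀ - δ) (x₀ + δ)).norm_image_sub_le_of_norm_hasDerivWithin_le
      (f := fun s => _) (fun s hs => (hdx hf s y (hIU s hs y hy)).hasDerivWithinAt)
      (fun s hs => hfM _ (hI s hs y hy)) hx hx'
  have hB1 := lip hB fun z hz => (hMBx z hz).trans hM3
  have hB1' := lip hBx fun z hz => (hMBxx z hz).trans hM4
  obtain ⟨W, hW0, hW⟩ := exists_total_differential_on_square (A := fun x y => A (x, y))
    (B := fun x y => B (x, y)) (Ay := fun x y => fderiv ℝ A (x, y) (0, 1))
    (Bx := fun x y => fderiv ℝ B (x, y) (1, 0)) hδ.le hM0.le hMδ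
    (fun x hx => (hdx hA x y₀ (hIU x hx y₀ ⟨by linarith, by linarith⟩)).continuousAt.continuousWithinAt)
    (fun x hx y hy => (hdy hB x y (hIU x hx y hy)).continuousAt.continuousWithinAt)
    (fun x hx y hy => (hMA _ (hI x hx y hy)).trans hM1)
    (fun x hx y hy => (hMB _ (hI x hx y hy)).trans hM2)
    (fun x hx y hy => (hdy hA x y (hIU x hx y hy)).hasDerivWithinAt)
    hB1
    (by
      intro x hx x' hx' y hy
      have hsub : uIcc x x' ⊆ Icc (x₀ - δ) (x₀ + δ) := uIcc_subset_Icc hx hx'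
      -- The second-order remainder of B is the increment of s ↦ B(s,y) - s·Bx(x,y), whose
      -- derivative Bx(s,y) - Bx(x,y) has norm at most M|x' - x|.
      have h := (convex_uIcc x x').norm_image_sub_le_of_norm_hasDerivWithin_le
        (f := fun s => B (s, y) - s • fderiv ℝ B (x, y) (1, 0))
        (f' := fun s => fderiv ℝ B (s, y) (1, 0) - (1 : ℝ) • fderiv ℝ B (x, y) (1, 0))
        (C := M * ‖x' - x‖)
        (fun s hs => ((hdx hB s y (hIU s (hsub hs) y hy)).sub
          ((hasDerivAt_id s).smul_const _)).hasDerivWithinAt)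
        (fun s hs => by
          rw [one_smul]
          refine (hB1' x hx s (hsub hs) y hy).trans ?_
          have : ‖s - x‖ ≤ ‖x' - x‖ := by
            simpa [Real.norm_eq_abs] using abs_sub_left_of_mem_uIcc hs
          gcongr) left_mem_uIcc right_mem_uIcc
      calc _ = ‖B (x', y) - x' • fderiv ℝ B (x, y) (1, 0) -
            (B (x, y) - x • fderiv ℝ B (x, y) (1, 0))‖ := by
            congr 1; rw [sub_smul]; abel
        _ ≤ M * ‖x' - x‖ * ‖x' - x‖ := h
        _ = _ := by ring)
    (fun x hx y hy w => hint _ (hIU x hx y hy) w) w₀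
  have hVsub : ∀ z ∈ Ioo (x₀ - δ) (x₀ + δ) ×ˢ Ioo (y₀ - δ) (y₀ + δ),
      z.1 ∈ Icc (x₀ - δ) (x₀ + δ) ∧ z.2 ∈ Icc (y₀ - δ) (y₀ + δ) := fun z hz =>
    ⟨Ioo_subset_Icc_self hz.1, Ioo_subset_Icc_self hz.2⟩
  have hVo : IsOpen (Ioo (x₀ - δ) (x₀ + δ) ×ˢ Ioo (y₀ - δ) (y₀ + δ)) := isOpen_Ioo.prod isOpen_Ioo
  have hVU : Ioo (x₀ - δ) (x₀ + δ) ×ˢ Ioo (y₀ - δ) (y₀ + δ) ⊆ U := fun z hz =>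
    hIU z.1 (hVsub z hz).1 z.2 (hVsub z hz).2
  have hWc : ContinuousOn (fun z : ℝ × ℝ => W z.1 z.2)
      (Ioo (x₀ - δ) (x₀ + δ) ×ˢ Ioo (y₀ - δ) (y₀ + δ)) := by
    have h1 : ContinuousOn (fun z : ℝ × ℝ => W z.1 z.2)
        (Icc (x₀ - δ) (x₀ + δ) ×ˢ Icc (y₀ - δ) (y₀ + δ)) := by
      -- Joint continuity: W is continuous in y, and Lipschitz in x uniformly in y since ‖A‖ ≤ M and
      -- ‖W‖ ≤ 4‖w₀‖.
      refine continuousOn_prod_of_continuousOn_lipschitzOnWith _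
        (⟨M * (4 * ‖w₀‖), by positivity⟩ : NNReal)
        (fun x hx y hy => (hW x hx y hy).2.1.continuousWithinAt) (fun y hy => ?_)
      refine (convex_Icc _ _).lipschitzOnWith_of_nnnorm_hasDerivWithin_le
        (fun x hx => (hW x hx y hy).1) (fun x hx => ?_)
      change ‖A (x, y) (W x y)‖ ≤ M * (4 * ‖w₀‖)
      have h1 := (hMA _ (hI x hx y hy)).trans hM1
      have h2 := (hW x hx y hy).2.2
      exact ((A (x, y)).le_opNorm _).trans (by gcongr)
    exact h1.mono fun z hz => hVsub z hz
  have hWd : ∀ z ∈ Ioo (x₀ - δ) (x₀ + δ) ×ˢ Ioo (y₀ - δ) (y₀ + δ),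
      HasFDerivAt (fun z : ℝ × ℝ => W z.1 z.2)
        ((ContinuousLinearMap.fst ℝ ℝ ℝ).smulRight (A z (W z.1 z.2)) +
          (ContinuousLinearMap.snd ℝ ℝ ℝ).smulRight (B z (W z.1 z.2))) z := by
    intro z hz
    have hnear := hVo.mem_nhds hz
    have hAc : ContinuousAt (fun z : ℝ × ℝ => A z (W z.1 z.2)) z :=
      (((hA.continuousOn.mono hVU).clm_apply hWc).continuousAt hnear)
    have hBc : ContinuousAt (fun z : ℝ × ℝ => B z (W z.1 z.2)) z :=
      (((hB.continuousOn.mono hVU).clm_apply hWc).continuousAt hnear)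
    -- Partial derivatives that exist near `z` and are continuous at `z` combine into a total
    -- derivative.
    have h := hasStrictFDerivAt_uncurry_coprod (𝕜 := ℝ) (u := z) (f := W)
      (f₁ := fun x y => ContinuousLinearMap.toSpanSingleton ℝ (A (x, y) (W x y)))
      (f₂ := fun x y => ContinuousLinearMap.toSpanSingleton ℝ (B (x, y) (W x y)))
      (by
        filter_upwards [hnear] with v hv
        exact ((hW v.1 (hVsub v hv).1 v.2 (hVsub v hv).2).1.hasDerivAt
          (Icc_mem_nhds hv.1.1 hv.1.2)).hasFDerivAt)
      (by
        filter_upwards [hnear] with v hv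
        exact ((hW v.1 (hVsub v hv).1 v.2 (hVsub v hv).2).2.1.hasDerivAt
          (Icc_mem_nhds hv.2.1 hv.2.2)).hasFDerivAt)
      ((ContinuousLinearMap.toSpanSingletonCLE (𝕜 := ℝ) (E := E)).continuous.continuousAt.comp hAc)
      ((ContinuousLinearMap.toSpanSingletonCLE (𝕜 := ℝ) (E := E)).continuous.continuousAt.comp hBc)
    refine h.hasFDerivAt.congr_fderiv ?_
    ext <;> simp [Function.HasUncurry.uncurry]
  exact ⟨_, fun z => W z.1 z.2, hVo,
    ⟨⟨by linarith, by linarith⟩, ⟨by linarith, by linarith⟩⟩, hVU,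
    contDiffOn_of_total_differential hVo (hA.mono hVU) (hB.mono hVU) hWd, hW0, hWd⟩

end TotalDifferential

/-! ### Partial derivatives -/

theorem natCast_le_infty (n : ℕ) : (n : ℕ∞ω) ≤ ∞ := by exact_mod_cast le_top

section Partials

variable {U : Set (ℝ × ℝ)} {f g : ℝ × ℝ → ℝ}

theorem dx_eq_of_hasFDerivAt {f' : ℝ × ℝ →L[ℝ] ℝ} {z : ℝ × ℝ} (h : HasFDerivAt f f' z) :
    dx f z = f' (1, 0) :=
  (HasFDerivAt.comp_hasDerivAt (f := fun s : ℝ => (s, z.2)) z.1 h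
    ((hasDerivAt_id z.1).prodMk (hasDerivAt_const z.1 z.2))).deriv

theorem dy_eq_of_hasFDerivAt {f' : ℝ × ℝ →L[ℝ] ℝ} {z : ℝ × ℝ} (h : HasFDerivAt f f' z) :
    dy f z = f' (0, 1) :=
  (HasFDerivAt.comp_hasDerivAt (f := fun s : ℝ => (z.1, s)) z.2 h
    ((hasDerivAt_const z.2 z.1).prodMk (hasDerivAt_id z.2))).deriv

theorem hasFDerivAt_of_smooth (hU : IsOpen U) (hf : ContDiffOn ℝ ∞ f U) {z : ℝ × ℝ} (hz : z ∈ U) :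
    HasFDerivAt f (fderiv ℝ f z) z :=
  ((hf.differentiableOn (by simp)).differentiableAt (hU.mem_nhds hz)).hasFDerivAt

theorem dx_eq_fderiv (hU : IsOpen U) (hf : ContDiffOn ℝ ∞ f U) {z : ℝ × ℝ} (hz : z ∈ U) :
    dx f z = fderiv ℝ f z (1, 0) :=
  dx_eq_of_hasFDerivAt (hasFDerivAt_of_smooth hU hf hz)

theorem dy_eq_fderiv (hU : IsOpen U) (hf : ContDiffOn ℝ ∞ f U) {z : ℝ × ℝ} (hz : z ∈ U) :
    dy f z = fderiv ℝ f z (0, 1) :=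
  dy_eq_of_hasFDerivAt (hasFDerivAt_of_smooth hU hf hz)

theorem contDiffOn_dx (hU : IsOpen U) (hf : ContDiffOn ℝ ∞ f U) : ContDiffOn ℝ ∞ (dx f) U :=
  ((hf.fderiv_of_isOpen hU (by simp)).clm_apply contDiffOn_const).congr
    fun _ hz => dx_eq_fderiv hU hf hz

theorem contDiffOn_dy (hU : IsOpen U) (hf : ContDiffOn ℝ ∞ f U) : ContDiffOn ℝ ∞ (dy f) U :=
  ((hf.fderiv_of_isOpen hU (by simp)).clm_apply contDiffOn_const).congr
    fun _ hz => dy_eq_fderiv hU hf hz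

/-- The derivative of a function of two variables along a graph. -/
theorem hasDerivAt_along (hU : IsOpen U) (hf : ContDiffOn ℝ ∞ f U) {y : ℝ → ℝ} {x y' : ℝ}
    (hy : HasDerivAt y y' x) (hz : (x, y x) ∈ U) :
    HasDerivAt (fun t => f (t, y t)) (dx f (x, y x) + dy f (x, y x) * y') x := by
  have h := HasFDerivAt.comp_hasDerivAt (f := fun t : ℝ => (t, y t)) x
    (hasFDerivAt_of_smooth hU hf hz) ((hasDerivAt_id x).prodMk hy)
  refine h.congr_deriv ?_
  have e : ((1, y') : ℝ × ℝ) = (1, 0) + y' • (0, 1) := by simp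
  rw [e, map_add, map_smul, dx_eq_fderiv hU hf hz, dy_eq_fderiv hU hf hz, smul_eq_mul, mul_comm y']

theorem hasDerivAt_dx (hU : IsOpen U) (hf : ContDiffOn ℝ ∞ f U) {z : ℝ × ℝ} (hz : z ∈ U) :
    HasDerivAt (fun t => f (t, z.2)) (dx f z) z.1 := by
  have h := HasFDerivAt.comp_hasDerivAt (f := fun s : ℝ => (s, z.2)) z.1
    (hasFDerivAt_of_smooth hU hf hz) ((hasDerivAt_id z.1).prodMk (hasDerivAt_const z.1 z.2))
  exact h.differentiableAt.hasDerivAt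

theorem hasDerivAt_dy (hU : IsOpen U) (hf : ContDiffOn ℝ ∞ f U) {z : ℝ × ℝ} (hz : z ∈ U) :
    HasDerivAt (fun t => f (z.1, t)) (dy f z) z.2 := by
  have h := HasFDerivAt.comp_hasDerivAt (f := fun s : ℝ => (z.1, s)) z.2
    (hasFDerivAt_of_smooth hU hf hz) ((hasDerivAt_const z.2 z.1).prodMk (hasDerivAt_id z.2))
  exact h.differentiableAt.hasDerivAt

theorem eventually_mem_fst (hU : IsOpen U) {z : ℝ × ℝ} (hz : z ∈ U) :
    ∀ᶠ t in nhds z.1, (t, z.2) ∈ U :=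
  (Continuous.prodMk_left z.2).continuousAt.eventually (hU.mem_nhds hz)

theorem eventually_mem_snd (hU : IsOpen U) {z : ℝ × ℝ} (hz : z ∈ U) :
    ∀ᶠ t in nhds z.2, (z.1, t) ∈ U :=
  (Continuous.prodMk_right z.1).continuousAt.eventually (hU.mem_nhds hz)

theorem dx_congr (hU : IsOpen U) (h : ∀ z ∈ U, f z = g z) {z : ℝ × ℝ} (hz : z ∈ U) :
    dx f z = dx g z := by
  refine Filter.EventuallyEq.deriv_eq ?_
  filter_upwards [eventually_mem_fst hU hz] with t ht using h _ ht

theorem dy_congr (hU : IsOpen U) (h : ∀ z ∈ U, f z = g z) {z : ℝ × ℝ} (hz : z ∈ U) :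
    dy f z = dy g z := by
  refine Filter.EventuallyEq.deriv_eq ?_
  filter_upwards [eventually_mem_snd hU hz] with t ht using h _ ht

theorem dx_dy_comm (hU : IsOpen U) (hf : ContDiffOn ℝ ∞ f U) {z : ℝ × ℝ} (hz : z ∈ U) :
    dx (dy f) z = dy (dx f) z := by
  have hsym : IsSymmSndFDerivAt ℝ f z :=
    (hf.contDiffAt (hU.mem_nhds hz)).isSymmSndFDerivAt (by
      rw [minSmoothness_of_isRCLikeNormedField]; exact natCast_le_infty 2)
  have hd : HasFDerivAt (fderiv ℝ f) (fderiv ℝ (fderiv ℝ f) z) z :=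
    (((hf.fderiv_of_isOpen hU (m := ∞) (by simp)).differentiableOn (by simp)).differentiableAt
      (hU.mem_nhds hz)).hasFDerivAt
  have h1 : dx (dy f) z = fderiv ℝ (fderiv ℝ f) z (1, 0) (0, 1) := by
    rw [dx_congr hU (fun w hw => dy_eq_fderiv hU hf hw) hz,
      dx_eq_of_hasFDerivAt (hd.clm_apply (hasFDerivAt_const (0, 1) z))]
    simp
  have h2 : dy (dx f) z = fderiv ℝ (fderiv ℝ f) z (0, 1) (1, 0) := by
    rw [dy_congr hU (fun w hw => dx_eq_fderiv hU hf hw) hz,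
      dy_eq_of_hasFDerivAt (hd.clm_apply (hasFDerivAt_const (1, 0) z))]
    simp
  rw [h1, h2, hsym.eq]

theorem dx_const_mul (hU : IsOpen U) (hf : ContDiffOn ℝ ∞ f U) (k : ℝ) {z : ℝ × ℝ} (hz : z ∈ U) :
    dx (fun w => k * f w) z = k * dx f z :=
  ((hasDerivAt_dx hU hf hz).const_mul k).deriv

theorem dy_const_mul (hU : IsOpen U) (hf : ContDiffOn ℝ ∞ f U) (k : ℝ) {z : ℝ × ℝ} (hz : z ∈ U) :
    dy (fun w => k * f w) z = k * dy f z :=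
  ((hasDerivAt_dy hU hf hz).const_mul k).deriv

theorem dx_mul (hU : IsOpen U) (hf : ContDiffOn ℝ ∞ f U) (hg : ContDiffOn ℝ ∞ g U)
    {z : ℝ × ℝ} (hz : z ∈ U) :
    dx (fun w => f w * g w) z = dx f z * g z + f z * dx g z :=
  ((hasDerivAt_dx hU hf hz).mul (hasDerivAt_dx hU hg hz)).deriv

theorem dy_mul (hU : IsOpen U) (hf : ContDiffOn ℝ ∞ f U) (hg : ContDiffOn ℝ ∞ g U)
    {z : ℝ × ℝ} (hz : z ∈ U) :
    dy (fun w => f w * g w) z = dy f z * g z + f z * dy g z :=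
  ((hasDerivAt_dy hU hf hz).mul (hasDerivAt_dy hU hg hz)).deriv

end Partials

/-! ### Curves with prescribed jets -/

theorem hasDerivAt_iteratedDeriv {I : Set ℝ} (hI : IsOpen I) {y : ℝ → ℝ} {n k : ℕ}
    (hy : ContDiffOn ℝ n y I) (hk : k < n) {t : ℝ} (ht : t ∈ I) :
    HasDerivAt (iteratedDeriv k y) (iteratedDeriv (k + 1) y t) t := by
  have h1 : DifferentiableOn ℝ (iteratedDerivWithin k y I) I :=
    hy.differentiableOn_iteratedDerivWithin (by exact_mod_cast hk) hI.uniqueDiffOn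
  have h2 : DifferentiableOn ℝ (iteratedDeriv k y) I :=
    h1.congr fun s hs => (iteratedDerivWithin_of_isOpen hI hs).symm
  rw [iteratedDeriv_succ]
  exact (h2.differentiableAt (hI.mem_nhds ht)).hasDerivAt

theorem iteratedDeriv_two_eq_of_hasDerivAt {f f' : ℝ → ℝ} {f'' x : ℝ}
    (h : ∀ᶠ t in nhds x, HasDerivAt f (f' t) t) (h' : HasDerivAt f' f'' x) :
    iteratedDeriv 2 f x = f'' := by
  rw [iteratedDeriv_succ, iteratedDeriv_one]
  have : deriv f =ᶠ[nhds x] f' := h.mono fun t ht => ht.deriv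
  rw [this.deriv_eq, h'.deriv]

/-- Turns a statement about all smooth curves into one about independent jet variables; the witness
is a Taylor polynomial of degree four. -/
theorem exists_contDiff_jet (x y₀ p q r s : ℝ) :
    ∃ y : ℝ → ℝ, ContDiff ℝ ∞ y ∧ y x = y₀ ∧ deriv y x = p ∧ iteratedDeriv 2 y x = q ∧
      iteratedDeriv 3 y x = r ∧ iteratedDeriv 4 y x = s := by
  have hp : ∀ n : ℕ, ∀ t, HasDerivAt (fun t : ℝ => (t - x) ^ n) (n * (t - x) ^ (n - 1)) t :=
    fun n t => by simpa using (((hasDerivAt_id t).sub_const x).fun_pow n)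
  have d1 : deriv (fun t => y₀ + p * (t - x) ^ 1 + q / 2 * (t - x) ^ 2 + r / 6 * (t - x) ^ 3 +
      s / 24 * (t - x) ^ 4) = fun t => p + q * (t - x) ^ 1 + r / 2 * (t - x) ^ 2 +
      s / 6 * (t - x) ^ 3 := by
    ext t
    refine ((((((hp 1 t).const_mul p).const_add y₀).add ((hp 2 t).const_mul (q / 2))).add
      ((hp 3 t).const_mul (r / 6))).add ((hp 4 t).const_mul (s / 24))).deriv.trans ?_
    norm_num; ring
  have d2 : deriv (fun t => p + q * (t - x) ^ 1 + r / 2 * (t - x) ^ 2 + s / 6 * (t - x) ^ 3) =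
      fun t => q + r * (t - x) ^ 1 + s / 2 * (t - x) ^ 2 := by
    ext t
    refine (((((hp 1 t).const_mul q).const_add p).add ((hp 2 t).const_mul (r / 2))).add
      ((hp 3 t).const_mul (s / 6))).deriv.trans ?_
    norm_num; ring
  have d3 : deriv (fun t => q + r * (t - x) ^ 1 + s / 2 * (t - x) ^ 2) =
      fun t => r + s * (t - x) ^ 1 := by
    ext t
    refine ((((hp 1 t).const_mul r).const_add q).add ((hp 2 t).const_mul (s / 2))).deriv.trans ?_
    norm_num; ring
  have d4 : deriv (fun t => r + s * (t - x) ^ 1) = fun _ => s := by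
    ext t
    refine (((hp 1 t).const_mul s).const_add r).deriv.trans ?_
    norm_num
  refine ⟨fun t => y₀ + p * (t - x) ^ 1 + q / 2 * (t - x) ^ 2 + r / 6 * (t - x) ^ 3 +
      s / 24 * (t - x) ^ 4, by fun_prop, by simp, ?_, ?_, ?_, ?_⟩
  · rw [d1]; simp
  · simp only [iteratedDeriv_succ, iteratedDeriv_zero]; rw [d1, d2]; simp
  · simp only [iteratedDeriv_succ, iteratedDeriv_zero]; rw [d1, d2, d3]; simp
  · simp only [iteratedDeriv_succ, iteratedDeriv_zero]; rw [d1, d2, d3, d4]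

/-! ### Total derivatives of the root equation -/

/-- The first total derivative of the left-hand side of the root equation. -/
def RootODE.totalDeriv (E : RootODE) (z : ℝ × ℝ) (p q r : ℝ) : ℝ :=
  r + (dx E.c z + dy E.c z * p) * p ^ 3 - (dx E.g z + dy E.g z * p) * p ^ 2
    + (dx E.h z + dy E.h z * p) * p - (dx E.d z + dy E.d z * p)
    + (3 * E.c z * p ^ 2 - 2 * E.g z * p + E.h z) * q

/-- The second total derivative of the left-hand side of the root equation. -/
def RootODE.totalDeriv₂ (E : RootODE) (z : ℝ × ℝ) (p q r s : ℝ) : ℝ :=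
  s + (dx (dx E.c) z + 2 * dy (dx E.c) z * p + dy (dy E.c) z * p ^ 2) * p ^ 3
    - (dx (dx E.g) z + 2 * dy (dx E.g) z * p + dy (dy E.g) z * p ^ 2) * p ^ 2
    + (dx (dx E.h) z + 2 * dy (dx E.h) z * p + dy (dy E.h) z * p ^ 2) * p
    - (dx (dx E.d) z + 2 * dy (dx E.d) z * p + dy (dy E.d) z * p ^ 2)
    + (dy E.c z * p ^ 3 - dy E.g z * p ^ 2 + dy E.h z * p - dy E.d z) * q
    + 2 * (3 * (dx E.c z + dy E.c z * p) * p ^ 2 - 2 * (dx E.g z + dy E.g z * p) * p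
      + (dx E.h z + dy E.h z * p)) * q
    + (6 * E.c z * p - 2 * E.g z) * q ^ 2
    + (3 * E.c z * p ^ 2 - 2 * E.g z * p + E.h z) * r

section

variable {U : Set (ℝ × ℝ)} {E : RootODE} {I : Set ℝ} {y : ℝ → ℝ}

theorem RootODE.hasDerivAt_lhs (hU : IsOpen U) (hE : E.SmoothOn U) (hI : IsOpen I)
    (hy : ContDiffOn ℝ 3 y I) {x : ℝ} (hx : x ∈ I) (hz : (x, y x) ∈ U) :
    HasDerivAt (E.lhs y)
      (E.totalDeriv (x, y x) (deriv y x) (iteratedDeriv 2 y x) (iteratedDeriv 3 y x)) x := by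
  obtain ⟨hc, hg, hh, hd⟩ := hE
  have h0 : HasDerivAt y (deriv y x) x := by
    simpa using hasDerivAt_iteratedDeriv (k := 0) hI (n := 3) hy (by norm_num) hx
  have h1 : HasDerivAt (deriv y) (iteratedDeriv 2 y x) x := by
    simpa using hasDerivAt_iteratedDeriv (k := 1) hI (n := 3) hy (by norm_num) hx
  have h2 : HasDerivAt (iteratedDeriv 2 y) (iteratedDeriv 3 y x) x :=
    hasDerivAt_iteratedDeriv hI (n := 3) hy (by norm_num) hx
  refine ((((h2.add ((hasDerivAt_along hU hc h0 hz).mul (h1.fun_pow 3))).sub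
    ((hasDerivAt_along hU hg h0 hz).mul (h1.fun_pow 2))).add
    ((hasDerivAt_along hU hh h0 hz).mul h1)).sub (hasDerivAt_along hU hd h0 hz)).congr_deriv ?_
  simp only [RootODE.totalDeriv]
  push_cast
  ring

theorem hasDerivAt_along_total (hU : IsOpen U) {f : ℝ × ℝ → ℝ} (hf : ContDiffOn ℝ ∞ f U) {x : ℝ}
    (h0 : HasDerivAt y (deriv y x) x) (h1 : HasDerivAt (deriv y) (iteratedDeriv 2 y x) x)
    (hz : (x, y x) ∈ U) :
    HasDerivAt (fun t => dx f (t, y t) + dy f (t, y t) * deriv y t)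
      (dx (dx f) (x, y x) + 2 * dy (dx f) (x, y x) * deriv y x
        + dy (dy f) (x, y x) * deriv y x ^ 2 + dy f (x, y x) * iteratedDeriv 2 y x) x := by
  refine ((hasDerivAt_along hU (contDiffOn_dx hU hf) h0 hz).add
    ((hasDerivAt_along hU (contDiffOn_dy hU hf) h0 hz).mul h1)).congr_deriv ?_
  rw [dx_dy_comm hU hf hz]
  ring

theorem RootODE.deriv_lhs (hU : IsOpen U) (hE : E.SmoothOn U) (hI : IsOpen I)
    (hy : ContDiffOn ℝ 4 y I) {x : ℝ} (hx : x ∈ I) (hz : (x, y x) ∈ U) :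
    deriv (E.lhs y) x =
      E.totalDeriv (x, y x) (deriv y x) (iteratedDeriv 2 y x) (iteratedDeriv 3 y x) ∧
    iteratedDeriv 2 (E.lhs y) x = E.totalDeriv₂ (x, y x) (deriv y x) (iteratedDeriv 2 y x)
      (iteratedDeriv 3 y x) (iteratedDeriv 4 y x) := by
  have hy3 : ContDiffOn ℝ 3 y I := hy.of_le (by norm_num)
  refine ⟨(hasDerivAt_lhs hU hE hI hy3 hx hz).deriv, ?_⟩
  have hev : ∀ᶠ t in nhds x, t ∈ I ∧ (t, y t) ∈ U := by
    have hyc : ContinuousAt y x := hy.continuousOn.continuousAt (hI.mem_nhds hx)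
    exact (hI.eventually_mem hx).and
      ((continuousAt_id.prodMk hyc).eventually (hU.mem_nhds hz))
  refine iteratedDeriv_two_eq_of_hasDerivAt
    (hev.mono fun t ht => hasDerivAt_lhs hU hE hI hy3 ht.1 ht.2) ?_
  obtain ⟨hc, hg, hh, hd⟩ := hE
  have h0 : HasDerivAt y (deriv y x) x := by
    simpa using hasDerivAt_iteratedDeriv (k := 0) hI (n := 4) hy (by norm_num) hx
  have h1 : HasDerivAt (deriv y) (iteratedDeriv 2 y x) x := by
    simpa using hasDerivAt_iteratedDeriv (k := 1) hI (n := 4) hy (by norm_num) hx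
  have h2 : HasDerivAt (iteratedDeriv 2 y) (iteratedDeriv 3 y x) x :=
    hasDerivAt_iteratedDeriv hI (n := 4) hy (by norm_num) hx
  have h3 : HasDerivAt (iteratedDeriv 3 y) (iteratedDeriv 4 y x) x :=
    hasDerivAt_iteratedDeriv hI (n := 4) hy (by norm_num) hx
  refine (((((h3.add ((hasDerivAt_along_total hU hc h0 h1 hz).mul (h1.fun_pow 3))).sub
    ((hasDerivAt_along_total hU hg h0 h1 hz).mul (h1.fun_pow 2))).add
    ((hasDerivAt_along_total hU hh h0 h1 hz).mul h1)).sub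
    (hasDerivAt_along_total hU hd h0 h1 hz)).add
    ((((((hasDerivAt_along hU hc h0 hz).const_mul 3).mul (h1.fun_pow 2)).sub
      (((hasDerivAt_along hU hg h0 hz).const_mul 2).mul h1)).add
      (hasDerivAt_along hU hh h0 hz)).mul h2)).congr_deriv ?_
  simp only [RootODE.totalDeriv₂, Pi.add_apply, Pi.sub_apply, Pi.mul_apply]
  push_cast
  ring

end

/-! ### Comparison of coefficients -/

/-- Seven values determine a polynomial of degree six; 0, ±1, ±2, ±3 are used. -/
theorem coeff_eq_zero_of_sextic {c0 c1 c2 c3 c4 c5 c6 : ℝ}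
    (h : ∀ p : ℝ, c6 * p ^ 6 + c5 * p ^ 5 + c4 * p ^ 4 + c3 * p ^ 3 + c2 * p ^ 2 + c1 * p + c0 = 0) :
    c0 = 0 ∧ c1 = 0 ∧ c2 = 0 ∧ c3 = 0 ∧ c4 = 0 ∧ c5 = 0 ∧ c6 = 0 := by
  have h0 := h 0
  have h1 := h 1
  have h2 := h (-1)
  have h3 := h 2
  have h4 := h (-2)
  have h5 := h 3
  have h6 := h (-3)
  norm_num at h0 h1 h2 h3 h4 h5 h6
  refine ⟨?_, ?_, ?_, ?_, ?_, ?_, ?_⟩ <;> linarith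

/-- The left-hand side of the fourth-order equation, without its leading term, on jets. -/
def QuadODE.lowerTerms (F : QuadODE) (z : ℝ × ℝ) (p q : ℝ) : ℝ :=
  (F.Q1 z * p - F.Q0 z) * q ^ 2
    - (F.R4 z * p ^ 4 - F.R3 z * p ^ 3 + F.R2 z * p ^ 2 - F.R1 z * p + F.R0 z) * q
    - (F.S6 z * p ^ 6 - F.S5 z * p ^ 5 + F.S4 z * p ^ 4 - F.S3 z * p ^ 3 + F.S2 z * p ^ 2
      - F.S1 z * p + F.S0 z)

theorem QuadODE.lhs_eq (F : QuadODE) (y : ℝ → ℝ) (x : ℝ) :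
    F.lhs y x = iteratedDeriv 4 y x
      + F.lowerTerms (x, y x) (deriv y x) (iteratedDeriv 2 y x) := by
  simp only [QuadODE.lhs, QuadODE.lowerTerms]
  ring

theorem arisesFrom_iff_jets {U : Set (ℝ × ℝ)} (hU : IsOpen U) {F : QuadODE} {E : RootODE}
    (hE : E.SmoothOn U) :
    ArisesFrom U F E ↔ ∀ z ∈ U, ∀ p q r s : ℝ, E.totalDeriv z p q r = 0 →
      s + F.lowerTerms z p q = E.totalDeriv₂ z p q r s := by
  constructor
  · rintro h ⟨x, y₀⟩ hz p q r s hr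
    obtain ⟨y, hy, rfl, rfl, rfl, rfl, rfl⟩ := exists_contDiff_jet x y₀ p q r s
    obtain ⟨e1, e2⟩ := RootODE.deriv_lhs hU hE isOpen_univ
      (hy.of_le (natCast_le_infty 4)).contDiffOn (Set.mem_univ x) hz
    rw [← QuadODE.lhs_eq, ← e2]
    exact h y hy x hz (e1.trans hr)
  · intro h y hy x hz hr
    obtain ⟨e1, e2⟩ := RootODE.deriv_lhs hU hE isOpen_univ
      (hy.of_le (natCast_le_infty 4)).contDiffOn (Set.mem_univ x) hz
    rw [QuadODE.lhs_eq, e2]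
    exact h _ hz _ _ _ _ (e1.symm.trans hr)

/-- The relations between the coefficients of the fourth-order equation and those of the root
equation obtained by comparing coefficients. -/
def CoefficientRelations (F : QuadODE) (E : RootODE) (z : ℝ × ℝ) : Prop :=
  (F.Q1 z = 6 * E.c z ∧ F.Q0 z = 2 * E.g z) ∧
  (F.R4 z = 9 * E.c z ^ 2 ∧
    F.R3 z = 12 * E.c z * E.g z + 7 * dy E.c z ∧
    F.R2 z = 4 * E.g z ^ 2 + 6 * E.c z * E.h z + 5 * dy E.g z - 6 * dx E.c z ∧
    F.R1 z = 4 * E.g z * E.h z + 3 * dy E.h z - 4 * dx E.g z ∧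
    F.R0 z = E.h z ^ 2 + dy E.d z - 2 * dx E.h z) ∧
  F.S6 z = 3 * E.c z * dy E.c z ∧
  F.S5 z = dy (dy E.c) z - 3 * E.c z * (dx E.c z - dy E.g z) + 2 * E.g z * dy E.c z ∧
  F.S4 z = -2 * dy (dx E.c) z + dy (dy E.g) z + 3 * E.c z * (dy E.h z - dx E.g z)
    - 2 * E.g z * (dx E.c z - dy E.g z) + E.h z * dy E.c z ∧
  F.S3 z = dx (dx E.c) z - 2 * dy (dx E.g) z + dy (dy E.h) z - 3 * E.c z * (dx E.h z - dy E.d z)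
    + 2 * E.g z * (dy E.h z - dx E.g z) - E.h z * (dx E.c z - dy E.g z) ∧
  F.S2 z = dx (dx E.g) z - 2 * dy (dx E.h) z + dy (dy E.d) z - 3 * E.c z * dx E.d z
    - 2 * E.g z * (dx E.h z - dy E.d z) + E.h z * (dy E.h z - dx E.g z) ∧
  F.S1 z = dx (dx E.h) z - 2 * dy (dx E.d) z - 2 * E.g z * dx E.d z
    - E.h z * (dx E.h z - dy E.d z) ∧
  F.S0 z = dx (dx E.d) z - E.h z * dx E.d z

/-- `totalDeriv` is r plus an expression free of r, so its vanishing means r = -`totalDeriv` z p q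
0. After this substitution s cancels, and an identity between polynomials in p and q is left. -/
theorem jets_iff_coefficientRelations (F : QuadODE) (E : RootODE) (z : ℝ × ℝ) :
    (∀ p q r s : ℝ, E.totalDeriv z p q r = 0 →
      s + F.lowerTerms z p q = E.totalDeriv₂ z p q r s) ↔ CoefficientRelations F E z := by
  constructor
  · intro h
    have key : ∀ p q : ℝ, F.lowerTerms z p q
        = E.totalDeriv₂ z p q (-E.totalDeriv z p q 0) 0 := by
      intro p q
      have := h p q (-E.totalDeriv z p q 0) 0 (by simp only [RootODE.totalDeriv]; ring)
      linarith
    simp only [QuadODE.lowerTerms, RootODE.totalDeriv₂, RootODE.totalDeriv] at key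
    -- The value at q = 0 isolates the S-coefficients, the odd part in q the R-coefficients, and the
    -- even part minus the value at 0 the Q-coefficients. The minus signs follow the alternating
    -- signs in (F).
    obtain ⟨a0, a1, a2, a3, a4, a5, a6⟩ := coeff_eq_zero_of_sextic
      (c0 := F.S0 z - (dx (dx E.d) z - E.h z * dx E.d z))
      (c1 := -(F.S1 z - (dx (dx E.h) z - 2 * dy (dx E.d) z - 2 * E.g z * dx E.d z
        - E.h z * (dx E.h z - dy E.d z))))
      (c2 := F.S2 z - (dx (dx E.g) z - 2 * dy (dx E.h) z + dy (dy E.d) z - 3 * E.c z * dx E.d z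
        - 2 * E.g z * (dx E.h z - dy E.d z) + E.h z * (dy E.h z - dx E.g z)))
      (c3 := -(F.S3 z - (dx (dx E.c) z - 2 * dy (dx E.g) z + dy (dy E.h) z
        - 3 * E.c z * (dx E.h z - dy E.d z)
        + 2 * E.g z * (dy E.h z - dx E.g z) - E.h z * (dx E.c z - dy E.g z))))
      (c4 := F.S4 z - (-2 * dy (dx E.c) z + dy (dy E.g) z + 3 * E.c z * (dy E.h z - dx E.g z)
        - 2 * E.g z * (dx E.c z - dy E.g z) + E.h z * dy E.c z))
      (c5 := -(F.S5 z - (dy (dy E.c) z - 3 * E.c z * (dx E.c z - dy E.g z)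
        + 2 * E.g z * dy E.c z)))
      (c6 := F.S6 z - 3 * E.c z * dy E.c z)
      (fun p => by linear_combination -key p 0)
    obtain ⟨b0, b1, b2, b3, b4, -, -⟩ := coeff_eq_zero_of_sextic
      (c0 := F.R0 z - (E.h z ^ 2 + dy E.d z - 2 * dx E.h z))
      (c1 := -(F.R1 z - (4 * E.g z * E.h z + 3 * dy E.h z - 4 * dx E.g z)))
      (c2 := F.R2 z - (4 * E.g z ^ 2 + 6 * E.c z * E.h z + 5 * dy E.g z - 6 * dx E.c z))
      (c3 := -(F.R3 z - (12 * E.c z * E.g z + 7 * dy E.c z)))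
      (c4 := F.R4 z - 9 * E.c z ^ 2) (c5 := 0) (c6 := 0)
      (fun p => by linear_combination -(key p 1 - key p (-1)) / 2)
    obtain ⟨d0, d1, -⟩ := coeff_eq_zero_of_sextic
      (c0 := -(F.Q0 z - 2 * E.g z)) (c1 := F.Q1 z - 6 * E.c z)
      (c2 := 0) (c3 := 0) (c4 := 0) (c5 := 0) (c6 := 0)
      (fun p => by linear_combination (key p 1 + key p (-1)) / 2 - key p 0)
    refine ⟨⟨?_, ?_⟩, ⟨?_, ?_, ?_, ?_, ?_⟩, ?_, ?_, ?_, ?_, ?_, ?_, ?_⟩ <;> linarith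
  · rintro ⟨⟨q1, q0⟩, ⟨r4, r3, r2, r1, r0⟩, s6, s5, s4, s3, s2, s1, s0⟩ p q r s hr
    have hr' : r = -E.totalDeriv z p q 0 := by
      simp only [RootODE.totalDeriv] at hr ⊢; linarith
    subst hr'
    simp only [QuadODE.lowerTerms, RootODE.totalDeriv₂, RootODE.totalDeriv]
    rw [q1, q0, r4, r3, r2, r1, r0, s6, s5, s4, s3, s2, s1, s0]
    ring

/-! ### The integral formula -/

/-- Both directions are the fundamental theorem of calculus on vertical segments; openness of U
provides short segments around each point. -/
theorem integralFormula_iff {U : Set (ℝ × ℝ)} (hU : IsOpen U) {F : QuadODE} (hF : F.SmoothOn U)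
    {E : RootODE} (hE : E.SmoothOn U) :
    IntegralFormula U F E ↔
      ∀ z ∈ U, dy E.d z = F.R0 z - E.h z ^ 2 + 2 * dx E.h z := by
  obtain ⟨-, ⟨hR0, -⟩, -⟩ := hF
  obtain ⟨-, -, hh, hd⟩ := hE
  have hk : ContinuousOn (fun z => F.R0 z - E.h z ^ 2 + 2 * dx E.h z) U :=
    (hR0.continuousOn.sub (hh.continuousOn.pow 2)).add
      (continuousOn_const.mul (contDiffOn_dx hU hh).continuousOn)
  have hkt : ∀ x t, (x, t) ∈ U →
      ContinuousAt (fun t => F.R0 (x, t) - E.h (x, t) ^ 2 + 2 * dx E.h (x, t)) t :=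
    fun x t hz => ContinuousAt.comp (f := fun t : ℝ => (x, t))
      (hk.continuousAt (hU.mem_nhds hz)) (Continuous.prodMk_right x).continuousAt
  constructor
  · rintro h ⟨x, y₀⟩ hz
    obtain ⟨ε, hε, hball⟩ := Metric.eventually_nhds_iff_ball.1 (eventually_mem_snd hU hz)
    have hmeas : StronglyMeasurableAtFilter
        (fun t => F.R0 (x, t) - E.h (x, t) ^ 2 + 2 * dx E.h (x, t)) (nhds y₀) :=
      ContinuousOn.stronglyMeasurableAtFilter Metric.isOpen_ball
        (fun t ht => (hkt x t (hball t ht)).continuousWithinAt) y₀ (Metric.mem_ball_self hε)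
    have hint := intervalIntegral.integral_hasDerivAt_right
      (IntervalIntegrable.refl : IntervalIntegrable _ MeasureTheory.volume y₀ y₀)
      hmeas (hkt x y₀ hz)
    have heq : (fun t => E.d (x, t)) =ᶠ[nhds y₀] fun t =>
        (∫ s in y₀..t, (F.R0 (x, s) - E.h (x, s) ^ 2 + 2 * dx E.h (x, s))) + E.d (x, y₀) := by
      filter_upwards [Metric.ball_mem_nhds y₀ hε] with t ht
      refine h x y₀ t fun s hs => hball s ?_
      rw [Metric.mem_ball, Real.dist_eq] at ht ⊢
      exact (Set.abs_sub_left_of_mem_uIcc hs).trans_lt ht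
    exact heq.deriv_eq.trans (hint.add_const _).deriv
  · intro h x y₁ y₂ hseg
    have hder : ∀ t ∈ Set.uIcc y₁ y₂, HasDerivAt (fun t => E.d (x, t))
        (F.R0 (x, t) - E.h (x, t) ^ 2 + 2 * dx E.h (x, t)) t := fun t ht => by
      rw [← h _ (hseg t ht)]
      exact hasDerivAt_dy hU hd (hseg t ht)
    rw [intervalIntegral.integral_eq_sub_of_hasDerivAt hder
      (ContinuousOn.intervalIntegrable fun t ht => (hkt x t (hseg t ht)).continuousWithinAt)]
    ring

/-! ### The constraints -/

/-- The partial derivatives of a function that agrees with a multiple of a smooth function. -/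
theorem partials_of_eq_const_mul {U : Set (ℝ × ℝ)} (hU : IsOpen U) {f g : ℝ × ℝ → ℝ} {k : ℝ}
    (hf : ContDiffOn ℝ ∞ f U) (h : ∀ z ∈ U, g z = k * f z) {z : ℝ × ℝ} (hz : z ∈ U) :
    dx g z = k * dx f z ∧ dy g z = k * dy f z ∧ dx (dx g) z = k * dx (dx f) z ∧
      dy (dx g) z = k * dy (dx f) z ∧ dy (dy g) z = k * dy (dy f) z := by
  have hx : ∀ z ∈ U, dx g z = k * dx f z := fun z hz => by
    rw [dx_congr hU h hz, dx_const_mul hU hf k hz]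
  have hy : ∀ z ∈ U, dy g z = k * dy f z := fun z hz => by
    rw [dy_congr hU h hz, dy_const_mul hU hf k hz]
  refine ⟨hx z hz, hy z hz, ?_, ?_, ?_⟩
  · rw [dx_congr hU hx hz, dx_const_mul hU (contDiffOn_dx hU hf) k hz]
  · rw [dy_congr hU hx hz, dy_const_mul hU (contDiffOn_dx hU hf) k hz]
  · rw [dy_congr hU hy hz, dy_const_mul hU (contDiffOn_dy hU hf) k hz]

/-- A change of dictionary: one side is written in c, g, h, d, the other in Q₁, Q₀, R₀, h, d.
Translating needs the partial derivatives of Q₁ = 6c, Q₀ = 2g and R₀ = h² + d_y - 2h_x, which are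
available because these equalities hold on an open set. -/
theorem coefficientRelations_iff {U : Set (ℝ × ℝ)} (hU : IsOpen U) {F : QuadODE}
    (hF : F.SmoothOn U) {E : RootODE} (hE : E.SmoothOn U) :
    (∀ z ∈ U, CoefficientRelations F E z) ↔
      Identification U F E ∧ IntegralFormula U F E ∧ Constraints U F E := by
  rw [integralFormula_iff hU hF hE]
  obtain ⟨hc, hg, hh, hd⟩ := hE
  have partials : (∀ z ∈ U, F.Q1 z = 6 * E.c z) → (∀ z ∈ U, F.Q0 z = 2 * E.g z) →
      (∀ z ∈ U, F.R0 z = E.h z ^ 2 + dy E.d z - 2 * dx E.h z) → ∀ z ∈ U,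
      (dx F.Q1 z = 6 * dx E.c z ∧ dy F.Q1 z = 6 * dy E.c z ∧ dx (dx F.Q1) z = 6 * dx (dx E.c) z ∧
        dy (dx F.Q1) z = 6 * dy (dx E.c) z ∧ dy (dy F.Q1) z = 6 * dy (dy E.c) z) ∧
      (dx F.Q0 z = 2 * dx E.g z ∧ dy F.Q0 z = 2 * dy E.g z ∧ dx (dx F.Q0) z = 2 * dx (dx E.g) z ∧
        dy (dx F.Q0) z = 2 * dy (dx E.g) z ∧ dy (dy F.Q0) z = 2 * dy (dy E.g) z) ∧
      dx F.R0 z = 2 * E.h z * dx E.h z + dy (dx E.d) z - 2 * dx (dx E.h) z ∧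
      dy F.R0 z = 2 * E.h z * dy E.h z + dy (dy E.d) z - 2 * dy (dx E.h) z := by
    intro h1 h0 hR z hz
    refine ⟨partials_of_eq_const_mul hU hc h1 hz, partials_of_eq_const_mul hU hg h0 hz, ?_, ?_⟩
    · rw [dx_congr hU hR hz, ← dx_dy_comm hU hd hz]
      refine (((((hasDerivAt_dx hU hh hz).fun_pow 2).add
        (hasDerivAt_dx hU (contDiffOn_dy hU hd) hz)).sub
        ((hasDerivAt_dx hU (contDiffOn_dx hU hh) hz).const_mul 2))).deriv.trans ?_
      push_cast; ring
    · rw [dy_congr hU hR hz]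
      refine (((((hasDerivAt_dy hU hh hz).fun_pow 2).add
        (hasDerivAt_dy hU (contDiffOn_dy hU hd) hz)).sub
        ((hasDerivAt_dy hU (contDiffOn_dx hU hh) hz).const_mul 2))).deriv.trans ?_
      push_cast; ring
  constructor
  · intro h
    have hp := partials (fun z hz => (h z hz).1.1) (fun z hz => (h z hz).1.2)
      (fun z hz => (h z hz).2.1.2.2.2.2)
    refine ⟨fun z hz => ?_, fun z hz => ?_, fun z hz => ?_⟩
    all_goals
      obtain ⟨⟨q1, q0⟩, ⟨r4, r3, r2, r1, r0⟩, s6, s5, s4, s3, s2, s1, s0⟩ := h z hz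
      obtain ⟨⟨q1x, q1y, q1xx, q1xy, q1yy⟩, ⟨q0x, q0y, q0xx, q0xy, q0yy⟩, r0x, r0y⟩ := hp z hz
    · rw [q1x, q0y, q1, q0, r2]
      refine ⟨?_, ?_, ?_⟩ <;> ring
    · rw [r0]; ring
    · rw [q1x, q1y, q1xx, q1xy, q1yy, q0x, q0y, q0xx, q0xy, q0yy, r0x, r0y,
        q1, q0, r4, r3, r1, r0, s6, s5, s4, s3, s2, s1, s0]
      refine ⟨?_, ?_, ?_, ?_, ?_, ?_, ?_, ?_, ?_, ?_⟩ <;> ring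
  · rintro ⟨hid, hint, hcon⟩ z hz
    have e1 : ∀ z ∈ U, F.Q1 z = 6 * E.c z := fun z hz => by rw [(hid z hz).1]; ring
    have e0 : ∀ z ∈ U, F.Q0 z = 2 * E.g z := fun z hz => by rw [(hid z hz).2.1]; ring
    have eR : ∀ z ∈ U, F.R0 z = E.h z ^ 2 + dy E.d z - 2 * dx E.h z := fun z hz => by
      rw [hint z hz]; ring
    obtain ⟨⟨q1x, q1y, q1xx, q1xy, q1yy⟩, ⟨q0x, q0y, q0xx, q0xy, q0yy⟩, r0x, r0y⟩ :=
      partials e1 e0 eR z hz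
    have q1 := e1 z hz
    have q0 := e0 z hz
    have r0 := eR z hz
    obtain ⟨-, -, r2⟩ := hid z hz
    obtain ⟨r4, r3, r1, s6, s5, s4, s3, s2, s1, s0⟩ := hcon z hz
    rw [q1x, q0y, q1, q0] at r2
    rw [q1x, q1y, q1, q0, q0y, q1yy] at s5
    rw [q1] at r4
    rw [q1, q0, q1y] at r3
    rw [q0, q0x] at r1
    rw [q1, q1y] at s6
    rw [q0, q1x, q1y, q1, q0x, q0y, q1xy, q0yy] at s4
    rw [q1, r0, q1x, q0, q0x, q0y, q1xx, q0xy] at s3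
    rw [q1, q0, r0, q0x, r0y, q0xx] at s2
    rw [r0, r0x, q0] at s1
    refine ⟨⟨q1, q0⟩, ⟨?_, ?_, ?_, ?_, r0⟩, ?_, ?_, ?_, ?_, ?_, ?_, s0⟩
    · rw [r4]; ring
    · rw [r3]; ring
    · linear_combination -r2
    · rw [r1]; ring
    · rw [s6]; ring
    · rw [s5]; ring
    · rw [s4]; ring
    · rw [s3]; ring
    · rw [s2]; ring
    · rw [s1]; ring

theorem arisesFrom_iff {U : Set (ℝ × ℝ)} (hU : IsOpen U) {F : QuadODE}
    (hF : F.SmoothOn U) {E : RootODE} (hE : E.SmoothOn U) :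
    ArisesFrom U F E ↔ Identification U F E ∧ IntegralFormula U F E ∧ Constraints U F E := by
  rw [← coefficientRelations_iff hU hF hE, arisesFrom_iff_jets hU hE]
  exact forall₂_congr fun z _ => jets_iff_coefficientRelations F E z

/-! ### Solutions of the root equation -/

/-- The equation writes y'' as a smooth function of x, y, y', so regularity bootstraps. Two
applications bring a C² solution to the C⁴ demanded of solutions of (F). -/
theorem RootODE.IsSolution.contDiffOn_succ {U : Set (ℝ × ℝ)} {E : RootODE}
    (hE : E.SmoothOn U) {I : Set ℝ} {y : ℝ → ℝ} (h : E.IsSolution U I y) {n : ℕ}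
    (hy : ContDiffOn ℝ (n + 1) y I) : ContDiffOn ℝ (n + 1 + 1) y I := by
  obtain ⟨hI, hy2, hyU, hsol⟩ := h
  obtain ⟨hc, hg, hh, hd⟩ := hE
  have h1 := (contDiffOn_succ_iff_deriv_of_isOpen hI).1 hy
  have hy2' : ContDiffOn ℝ (1 + 1) y I := by norm_num; exact hy2
  have h2 := (contDiffOn_succ_iff_deriv_of_isOpen hI).1 hy2'
  rw [contDiffOn_succ_iff_deriv_of_isOpen hI]
  refine ⟨h1.1, by simp, ?_⟩
  rw [contDiffOn_succ_iff_deriv_of_isOpen hI]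
  refine ⟨h2.2.2.differentiableOn (by simp), by simp, ?_⟩
  have hgr : ContDiffOn ℝ n (fun x => (x, y x)) I := contDiffOn_id.prodMk (hy.of_le (by simp))
  have along : ∀ {f : ℝ × ℝ → ℝ}, ContDiffOn ℝ ∞ f U → ContDiffOn ℝ n (fun x => f (x, y x)) I :=
    fun hf => (hf.of_le (natCast_le_infty n)).comp hgr hyU
  have hrhs : ContDiffOn ℝ n (fun x => E.d (x, y x) - E.h (x, y x) * deriv y x
      + E.g (x, y x) * deriv y x ^ 2 - E.c (x, y x) * deriv y x ^ 3) I :=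
    (((along hd).sub ((along hh).mul h1.2.2)).add ((along hg).mul (h1.2.2.pow 2))).sub
      ((along hc).mul (h1.2.2.pow 3))
  refine hrhs.congr fun x hx => ?_
  have := hsol x hx
  rw [RootODE.lhs, iteratedDeriv_succ, iteratedDeriv_one] at this
  linarith

/-- Every solution of the root equation solves the fourth-order equation obtained from it. -/
theorem RootODE.IsSolution.quadODE {U : Set (ℝ × ℝ)} (hU : IsOpen U) {F : QuadODE} {E : RootODE}
    (hE : E.SmoothOn U) (hrel : ∀ z ∈ U, CoefficientRelations F E z) {I : Set ℝ} {y : ℝ → ℝ}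
    (h : E.IsSolution U I y) : F.IsSolution U I y := by
  have hy3 : ContDiffOn ℝ 3 y I := by
    have := h.contDiffOn_succ hE (n := 1) (by norm_num; exact h.2.1)
    norm_num at this
    exact this
  have hy4 : ContDiffOn ℝ 4 y I := by
    have := h.contDiffOn_succ hE (n := 2) (by norm_num; exact hy3)
    norm_num at this
    exact this
  obtain ⟨hI, -, hyU, hsol⟩ := h
  refine ⟨hI, hy4, hyU, fun x hx => ?_⟩
  have hzero : E.lhs y =ᶠ[nhds x] fun _ => 0 := by
    filter_upwards [hI.mem_nhds hx] with t ht using hsol t ht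
  obtain ⟨e1, e2⟩ := E.deriv_lhs hU hE hI hy4 hx (hyU x hx)
  have z1 : deriv (E.lhs y) x = 0 := by rw [hzero.deriv_eq]; simp
  have z2 : iteratedDeriv 2 (E.lhs y) x = 0 := by
    rw [hzero.iteratedDeriv_eq 2]; simp
  rw [QuadODE.lhs_eq, (jets_iff_coefficientRelations F E _).2 (hrel _ (hyU x hx)) _ _ _ _
    (e1.symm.trans z1), ← e2, z2]

/-! ### Total derivatives -/

/-- Compares first derivatives of G at a jet and at its projection by the chain rule alone. This
avoids mixed second derivatives, which a C¹ function need not have. -/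
theorem fderiv_apply_of_eq_comp_add {X : Type*} [NormedAddCommGroup X] [NormedSpace ℝ X]
    {Ω : Set X} (hΩ : IsOpen Ω) {G : X → ℝ} (hG : DifferentiableOn ℝ G Ω) {T : X →L[ℝ] X}
    (hT : ∀ j ∈ Ω, T j ∈ Ω) {ℓ : X →L[ℝ] ℝ} (h : ∀ j ∈ Ω, G j = G (T j) + ℓ j) {j : X}
    (hj : j ∈ Ω) (v : X) : fderiv ℝ G j v = fderiv ℝ G (T j) (T v) + ℓ v := by
  have hd := ((hG.differentiableAt (hΩ.mem_nhds (hT j hj))).hasFDerivAt.comp j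
    T.hasFDerivAt).add ℓ.hasFDerivAt
  have heq : G =ᶠ[nhds j] (G ∘ T) + ℓ := by
    filter_upwards [hΩ.mem_nhds hj] with i hi using h i hi
  rw [heq.fderiv_eq, hd.fderiv]
  rfl

theorem eq_of_forall_hasDerivAt_const {f : ℝ → ℝ} {k : ℝ} (h : ∀ t, HasDerivAt f k t) (t : ℝ) :
    f t = f 0 + k * t := by
  have h1 : ∀ s, HasDerivAt (fun s => f s - k * s) 0 s := fun s => by
    simpa using (h s).fun_sub ((hasDerivAt_id s).const_mul k)
  have h2 := is_const_of_deriv_eq_zero (fun s => (h1 s).differentiableAt)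
    (fun s => (h1 s).deriv) t 0
  simp only [mul_zero, sub_zero] at h2
  linarith

/-- If the left-hand side of the fourth-order equation is a total derivative, then it does not
contain the square of `y''`. -/
theorem IsTotalDerivative.quadratic_term_eq_zero {U : Set (ℝ × ℝ)} (hU : IsOpen U) {F : QuadODE}
    (h : IsTotalDerivative U F) : ∀ z ∈ U, F.Q1 z = 0 ∧ F.Q0 z = 0 := by
  obtain ⟨G, hG, hGF⟩ := h
  have hΩ : IsOpen {j : (ℝ × ℝ) × ℝ × ℝ × ℝ | j.1 ∈ U} := hU.preimage continuous_fst
  have hGd : DifferentiableOn ℝ G {j | j.1 ∈ U} := hG.differentiableOn (by simp)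
  have hGat : ∀ z ∈ U, ∀ w, HasFDerivAt G (fderiv ℝ G (z, w)) (z, w) := fun z hz w =>
    (hGd.differentiableAt (hΩ.mem_nhds hz)).hasFDerivAt
  -- Chain rule along a curve with the prescribed jet: r and s now occur as free variables.
  have jet : ∀ z ∈ U, ∀ p q r s : ℝ,
      s + F.lowerTerms z p q = fderiv ℝ G (z, p, q, r) ((1, p), q, r, s) := by
    rintro ⟨x, y₀⟩ hz p q r s
    obtain ⟨y, hy, rfl, rfl, rfl, rfl, rfl⟩ := exists_contDiff_jet x y₀ p q r s
    have hy4 : ContDiffOn ℝ (4 : ℕ) y Set.univ := (hy.of_le (natCast_le_infty 4)).contDiffOn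
    have h0 : HasDerivAt y (deriv y x) x := by
      simpa using hasDerivAt_iteratedDeriv (k := 0) isOpen_univ hy4 (by norm_num) (Set.mem_univ x)
    have h1 : HasDerivAt (deriv y) (iteratedDeriv 2 y x) x := by
      simpa using hasDerivAt_iteratedDeriv (k := 1) isOpen_univ hy4 (by norm_num) (Set.mem_univ x)
    have h2 := hasDerivAt_iteratedDeriv (k := 2) isOpen_univ hy4 (by norm_num) (Set.mem_univ x)
    have h3 := hasDerivAt_iteratedDeriv (k := 3) isOpen_univ hy4 (by norm_num) (Set.mem_univ x)
    have hd := HasFDerivAt.comp_hasDerivAt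
      (f := fun t => ((t, y t), deriv y t, iteratedDeriv 2 y t, iteratedDeriv 3 y t)) x
      (hGat _ hz _) (((hasDerivAt_id x).prodMk h0).prodMk (h1.prodMk (h2.prodMk h3)))
    rw [← QuadODE.lhs_eq, hGF y hy x hz]
    exact hd.deriv
  -- The coefficient of s on both sides of `jet` gives ∂G/∂r = 1.
  have d3 : ∀ z ∈ U, ∀ p q r, HasDerivAt (fun r => G (z, p, q, r)) 1 r := by
    intro z hz p q r
    refine (HasFDerivAt.comp_hasDerivAt (f := fun r => (z, p, q, r)) r (hGat z hz _)
      ((hasDerivAt_const r z).prodMk ((hasDerivAt_const r p).prodMk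
        ((hasDerivAt_const r q).prodMk (hasDerivAt_id r))))).congr_deriv ?_
    have e : ((0, 0, 0, 1) : (ℝ × ℝ) × ℝ × ℝ × ℝ) = ((1, p), q, r, 1) - ((1, p), q, r, 0) := by
      ext <;> simp
    rw [e, map_sub, ← jet z hz, ← jet z hz]
    ring
  have step3 : ∀ z ∈ U, ∀ p q r, G (z, p, q, r) = G (z, p, q, 0) + r := fun z hz p q r => by
    simpa using eq_of_forall_hasDerivAt_const (d3 z hz p q) r
  have jet' : ∀ z ∈ U, ∀ p q r : ℝ,
      F.lowerTerms z p q = fderiv ℝ G (z, p, q, 0) ((1, p), q, r, 0) := by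
    intro z hz p q r
    have := fderiv_apply_of_eq_comp_add hΩ hGd
      (T := (ContinuousLinearMap.id ℝ (ℝ × ℝ)).prodMap ((ContinuousLinearMap.id ℝ ℝ).prodMap
        ((ContinuousLinearMap.id ℝ ℝ).prodMap 0))) (fun j hj => hj)
      (ℓ := (ContinuousLinearMap.snd ℝ ℝ ℝ).comp ((ContinuousLinearMap.snd ℝ ℝ (ℝ × ℝ)).comp
        (ContinuousLinearMap.snd ℝ (ℝ × ℝ) (ℝ × ℝ × ℝ))))
      (fun j hj => step3 j.1 hj j.2.1 j.2.2.1 j.2.2.2) (j := (z, p, q, r)) hz ((1, p), q, r, 0)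
    rw [← jet z hz] at this
    simpa using this
  -- In `jet'` the left side is free of r, while r multiplies ∂G/∂q on the right; hence ∂G/∂q = 0.
  have d2 : ∀ z ∈ U, ∀ p q, HasDerivAt (fun q => G (z, p, q, 0)) 0 q := by
    intro z hz p q
    refine (HasFDerivAt.comp_hasDerivAt (f := fun q => (z, p, q, 0)) q (hGat z hz _)
      ((hasDerivAt_const q z).prodMk ((hasDerivAt_const q p).prodMk
        ((hasDerivAt_id q).prodMk (hasDerivAt_const q 0))))).congr_deriv ?_
    have e : ((0, 0, 1, 0) : (ℝ × ℝ) × ℝ × ℝ × ℝ) = ((1, p), q, 1, 0) - ((1, p), q, 0, 0) := by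
      ext <;> simp
    rw [e, map_sub, ← jet' z hz, ← jet' z hz]
    ring
  have step2 : ∀ z ∈ U, ∀ p q r, G (z, p, q, r) = G (z, p, 0, 0) + r := fun z hz p q r => by
    rw [step3 z hz, eq_of_forall_hasDerivAt_const (d2 z hz p) q]
    simp
  have affine : ∀ z ∈ U, ∀ p q : ℝ,
      F.lowerTerms z p q = fderiv ℝ G (z, p, 0, 0) ((1, p), q, 0, 0) := by
    intro z hz p q
    have := fderiv_apply_of_eq_comp_add hΩ hGd
      (T := (ContinuousLinearMap.id ℝ (ℝ × ℝ)).prodMap ((ContinuousLinearMap.id ℝ ℝ).prodMap 0))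
      (fun j hj => hj)
      (ℓ := (ContinuousLinearMap.snd ℝ ℝ ℝ).comp ((ContinuousLinearMap.snd ℝ ℝ (ℝ × ℝ)).comp
        (ContinuousLinearMap.snd ℝ (ℝ × ℝ) (ℝ × ℝ × ℝ))))
      (fun j hj => step2 j.1 hj j.2.1 j.2.2.1 j.2.2.2) (j := (z, p, q, 0)) hz ((1, p), q, 0, 0)
    rw [← jet z hz] at this
    simpa [Prod.mk_zero_zero] using this
  intro z hz
  have quad : ∀ p, F.Q1 z * p - F.Q0 z = 0 := by
    intro p
    -- The right side of `affine` is affine in q, so its second difference at q = 1, 0, -1 vanishes;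
    -- on the left this difference is 2(Q₁p - Q₀).
    have e : (((1, p), 1, 0, 0) : (ℝ × ℝ) × ℝ × ℝ × ℝ) + ((1, p), -1, 0, 0) =
        ((1, p), 0, 0, 0) + ((1, p), 0, 0, 0) := by
      ext <;> simp
    have h := congrArg (fderiv ℝ G (z, p, 0, 0)) e
    rw [map_add, map_add, ← affine z hz, ← affine z hz, ← affine z hz] at h
    simp only [QuadODE.lowerTerms] at h
    linarith
  have q0 := quad 0
  have q1 := quad 1
  constructor <;> linarith

/-! ### Linear systems for the second derivatives of one unknown function -/

/-- The linear form on `ℝ³` with the given coefficients. -/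
def linForm (k : ℝ × ℝ × ℝ) : ℝ × ℝ × ℝ →L[ℝ] ℝ :=
  k.1 • ContinuousLinearMap.fst ℝ ℝ (ℝ × ℝ) +
    k.2.1 • (ContinuousLinearMap.fst ℝ ℝ ℝ).comp (ContinuousLinearMap.snd ℝ ℝ (ℝ × ℝ)) +
    k.2.2 • (ContinuousLinearMap.snd ℝ ℝ ℝ).comp (ContinuousLinearMap.snd ℝ ℝ (ℝ × ℝ))

@[simp]
theorem linForm_apply (k s : ℝ × ℝ × ℝ) :
    linForm k s = k.1 * s.1 + k.2.1 * s.2.1 + k.2.2 * s.2.2 := rfl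

theorem contDiffOn_linForm {U : Set (ℝ × ℝ)} {k₁ k₂ k₃ : ℝ × ℝ → ℝ} (h₁ : ContDiffOn ℝ ∞ k₁ U)
    (h₂ : ContDiffOn ℝ ∞ k₂ U) (h₃ : ContDiffOn ℝ ∞ k₃ U) :
    ContDiffOn ℝ ∞ (fun z => linForm (k₁ z, k₂ z, k₃ z)) U :=
  ((h₁.smul contDiffOn_const).add (h₂.smul contDiffOn_const)).add (h₃.smul contDiffOn_const)

theorem contDiffOn_clm_prod {U : Set (ℝ × ℝ)} {A₁ A₂ A₃ : ℝ × ℝ → ℝ × ℝ × ℝ →L[ℝ] ℝ}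
    (h₁ : ContDiffOn ℝ ∞ A₁ U) (h₂ : ContDiffOn ℝ ∞ A₂ U) (h₃ : ContDiffOn ℝ ∞ A₃ U) :
    ContDiffOn ℝ ∞ (fun z => (A₁ z).prod ((A₂ z).prod (A₃ z))) U :=
  contDiffOn_clm_apply.2 fun _ => (h₁.clm_apply contDiffOn_const).prodMk
    ((h₂.clm_apply contDiffOn_const).prodMk (h₃.clm_apply contDiffOn_const))

/-- The linear system `u_xx = α·(u, u_x, u_y)`, `u_xy = β·(u, u_x, u_y)`, `u_yy = γ·(u, u_x, u_y)`
can be solved near every point with arbitrary initial values of `u, u_x, u_y`, provided that it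
is formally integrable. -/
theorem exists_hessian_system_solution {U : Set (ℝ × ℝ)} (hU : IsOpen U)
    {α₁ α₂ α₃ β₁ β₂ β₃ γ₁ γ₂ γ₃ : ℝ × ℝ → ℝ}
    (hα₁ : ContDiffOn ℝ ∞ α₁ U) (hα₂ : ContDiffOn ℝ ∞ α₂ U) (hα₃ : ContDiffOn ℝ ∞ α₃ U)
    (hβ₁ : ContDiffOn ℝ ∞ β₁ U) (hβ₂ : ContDiffOn ℝ ∞ β₂ U) (hβ₃ : ContDiffOn ℝ ∞ β₃ U)
    (hγ₁ : ContDiffOn ℝ ∞ γ₁ U) (hγ₂ : ContDiffOn ℝ ∞ γ₂ U) (hγ₃ : ContDiffOn ℝ ∞ γ₃ U)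
    (hint₁ : ∀ z ∈ U, ∀ u v w : ℝ,
      dy α₁ z * u + dy α₂ z * v + dy α₃ z * w + α₁ z * w
        + α₂ z * (β₁ z * u + β₂ z * v + β₃ z * w) + α₃ z * (γ₁ z * u + γ₂ z * v + γ₃ z * w) =
      dx β₁ z * u + dx β₂ z * v + dx β₃ z * w + β₁ z * v
        + β₂ z * (α₁ z * u + α₂ z * v + α₃ z * w) + β₃ z * (β₁ z * u + β₂ z * v + β₃ z * w))
    (hint₂ : ∀ z ∈ U, ∀ u v w : ℝ,
      dy β₁ z * u + dy β₂ z * v + dy β₃ z * w + β₁ z * w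
        + β₂ z * (β₁ z * u + β₂ z * v + β₃ z * w) + β₃ z * (γ₁ z * u + γ₂ z * v + γ₃ z * w) =
      dx γ₁ z * u + dx γ₂ z * v + dx γ₃ z * w + γ₁ z * v
        + γ₂ z * (α₁ z * u + α₂ z * v + α₃ z * w) + γ₃ z * (β₁ z * u + β₂ z * v + β₃ z * w))
    {z₀ : ℝ × ℝ} (hz₀ : z₀ ∈ U) (s₀ : ℝ × ℝ × ℝ) :
    ∃ (V : Set (ℝ × ℝ)) (u v w : ℝ × ℝ → ℝ), IsOpen V ∧ z₀ ∈ V ∧ V ⊆ U ∧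
      (ContDiffOn ℝ ∞ u V ∧ ContDiffOn ℝ ∞ v V ∧ ContDiffOn ℝ ∞ w V) ∧
      (u z₀ = s₀.1 ∧ v z₀ = s₀.2.1 ∧ w z₀ = s₀.2.2) ∧
      ∀ z ∈ V, dx u z = v z ∧ dy u z = w z ∧
        dx v z = α₁ z * u z + α₂ z * v z + α₃ z * w z ∧
        dy v z = β₁ z * u z + β₂ z * v z + β₃ z * w z ∧
        dx w z = β₁ z * u z + β₂ z * v z + β₃ z * w z ∧
        dy w z = γ₁ z * u z + γ₂ z * v z + γ₃ z * w z := by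
  have hα := contDiffOn_linForm hα₁ hα₂ hα₃
  have hβ := contDiffOn_linForm hβ₁ hβ₂ hβ₃
  have hγ := contDiffOn_linForm hγ₁ hγ₂ hγ₃
  -- First-order form for W = (u, u_x, u_y): the rows of W_x are u_x, α, β and those of W_y are u_y,
  -- β, γ.
  have hA := contDiffOn_clm_prod (contDiffOn_const (c := linForm (0, 1, 0))) hα hβ
  have hB := contDiffOn_clm_prod (contDiffOn_const (c := linForm (0, 0, 1))) hβ hγ
  have fd : ∀ {C : ℝ × ℝ → ℝ × ℝ × ℝ →L[ℝ] ℝ × ℝ × ℝ}, ContDiffOn ℝ ∞ C U → ∀ z ∈ U,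
      HasFDerivAt C (fderiv ℝ C z) z := fun hC z hz =>
    ((hC.differentiableOn (by simp)).differentiableAt (hU.mem_nhds hz)).hasFDerivAt
  obtain ⟨V, W, hVo, hzV, hVU, hW, hW0, hWd⟩ := exists_total_differential_solution hU hA hB
    (by
      rintro z hz ⟨u, v, w⟩
      have eA := (HasFDerivAt.comp_hasDerivAt (f := fun s : ℝ => (z.1, s)) z.2 (fd hA z hz)
        ((hasDerivAt_const z.2 z.1).prodMk (hasDerivAt_id z.2))).clm_apply
        (hasDerivAt_const z.2 (u, v, w))
      have eB := (HasFDerivAt.comp_hasDerivAt (f := fun s : ℝ => (s, z.2)) z.1 (fd hB z hz)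
        ((hasDerivAt_id z.1).prodMk (hasDerivAt_const z.1 z.2))).clm_apply
        (hasDerivAt_const z.1 (u, v, w))
      have lin_y : ∀ {k₁ k₂ k₃ : ℝ × ℝ → ℝ}, ContDiffOn ℝ ∞ k₁ U → ContDiffOn ℝ ∞ k₂ U →
          ContDiffOn ℝ ∞ k₃ U → HasDerivAt
            (fun t => k₁ (z.1, t) * u + k₂ (z.1, t) * v + k₃ (z.1, t) * w)
            (dy k₁ z * u + dy k₂ z * v + dy k₃ z * w) z.2 := fun h₁ h₂ h₃ =>
        (((hasDerivAt_dy hU h₁ hz).mul_const u).add ((hasDerivAt_dy hU h₂ hz).mul_const v)).add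
          ((hasDerivAt_dy hU h₃ hz).mul_const w)
      have lin_x : ∀ {k₁ k₂ k₃ : ℝ × ℝ → ℝ}, ContDiffOn ℝ ∞ k₁ U → ContDiffOn ℝ ∞ k₂ U →
          ContDiffOn ℝ ∞ k₃ U → HasDerivAt
            (fun t => k₁ (t, z.2) * u + k₂ (t, z.2) * v + k₃ (t, z.2) * w)
            (dx k₁ z * u + dx k₂ z * v + dx k₃ z * w) z.1 := fun h₁ h₂ h₃ =>
        (((hasDerivAt_dx hU h₁ hz).mul_const u).add ((hasDerivAt_dx hU h₂ hz).mul_const v)).add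
          ((hasDerivAt_dx hU h₃ hz).mul_const w)
      have uA := eA.unique ((hasDerivAt_const z.2 (0 * u + 1 * v + 0 * w)).prodMk
        ((lin_y hα₁ hα₂ hα₃).prodMk (lin_y hβ₁ hβ₂ hβ₃)))
      have uB := eB.unique ((hasDerivAt_const z.1 (0 * u + 0 * v + 1 * w)).prodMk
        ((lin_x hβ₁ hβ₂ hβ₃).prodMk (lin_x hγ₁ hγ₂ hγ₃)))
      simp only [map_zero, add_zero] at uA uB
      rw [uA, uB]
      have i₁ := hint₁ z hz u v w
      have i₂ := hint₂ z hz u v w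
      simp only [ContinuousLinearMap.prod_apply, linForm_apply, Prod.mk_add_mk, Prod.mk.injEq]
      -- The u-component is automatic, both mixed derivatives being given by β; the other two
      -- components are the hypotheses.
      refine ⟨?_, ?_, ?_⟩
      · ring
      · linear_combination i₁
      · linear_combination i₂) hz₀ s₀
  have p1 : ∀ z ∈ V, _ := fun z hz =>
    (ContinuousLinearMap.fst ℝ ℝ (ℝ × ℝ)).hasFDerivAt.comp z (hWd z hz)
  have p2 : ∀ z ∈ V, _ := fun z hz =>
    ((ContinuousLinearMap.fst ℝ ℝ ℝ).comp
      (ContinuousLinearMap.snd ℝ ℝ (ℝ × ℝ))).hasFDerivAt.comp z (hWd z hz)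
  have p3 : ∀ z ∈ V, _ := fun z hz =>
    ((ContinuousLinearMap.snd ℝ ℝ ℝ).comp
      (ContinuousLinearMap.snd ℝ ℝ (ℝ × ℝ))).hasFDerivAt.comp z (hWd z hz)
  refine ⟨V, fun z => (W z).1, fun z => (W z).2.1, fun z => (W z).2.2, hVo, hzV, hVU,
    ⟨contDiff_fst.comp_contDiffOn hW, (contDiff_fst.comp contDiff_snd).comp_contDiffOn hW,
      (contDiff_snd.comp contDiff_snd).comp_contDiffOn hW⟩, by simp [hW0], fun z hz =>
    ⟨?_, ?_, ?_, ?_, ?_, ?_⟩⟩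
  · exact (dx_eq_of_hasFDerivAt (p1 z hz)).trans (by simp)
  · exact (dy_eq_of_hasFDerivAt (p1 z hz)).trans (by simp)
  · exact (dx_eq_of_hasFDerivAt (p2 z hz)).trans (by simp)
  · exact (dy_eq_of_hasFDerivAt (p2 z hz)).trans (by simp)
  · exact (dx_eq_of_hasFDerivAt (p3 z hz)).trans (by simp)
  · exact (dy_eq_of_hasFDerivAt (p3 z hz)).trans (by simp)

/-! ### The projective frame of a root equation satisfying the Lie–Tresse criteria -/

/-- The coefficient of `u` in the equation for `u_xx`. -/
def RootODE.hessXX (E : RootODE) (z : ℝ × ℝ) : ℝ :=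
  dx E.h z / 3 + 2 * E.h z ^ 2 / 9 + dy E.d z - 2 * (E.d z * E.g z) / 3

/-- The coefficient of `u` in the equation for `u_xy`. -/
def RootODE.hessXY (E : RootODE) (z : ℝ × ℝ) : ℝ :=
  E.c z * E.d z - E.g z * E.h z / 9 - (dy E.h z + dx E.g z) / 3

/-- The coefficient of `u` in the equation for `u_yy`. -/
def RootODE.hessYY (E : RootODE) (z : ℝ × ℝ) : ℝ :=
  dy E.g z / 3 + 2 * E.g z ^ 2 / 9 + dx E.c z - 2 * (E.c z * E.h z) / 3

/-- `u`, together with `v = u_x` and `w = u_y`, solves the linear system attached to the root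
equation. The quotients of two solutions are the coordinates that linearize the equation. -/
structure RootODE.IsFrameOn (E : RootODE) (V : Set (ℝ × ℝ)) (u v w : ℝ × ℝ → ℝ) : Prop where
  smooth : ContDiffOn ℝ ∞ u V ∧ ContDiffOn ℝ ∞ v V ∧ ContDiffOn ℝ ∞ w V
  dx_u : ∀ z ∈ V, dx u z = v z
  dy_u : ∀ z ∈ V, dy u z = w z
  dx_v : ∀ z ∈ V, dx v z = E.hessXX z * u z - E.h z / 3 * v z - E.d z * w z
  dy_v : ∀ z ∈ V, dy v z = E.hessXY z * u z + E.g z / 3 * v z + E.h z / 3 * w z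
  dx_w : ∀ z ∈ V, dx w z = E.hessXY z * u z + E.g z / 3 * v z + E.h z / 3 * w z
  dy_w : ∀ z ∈ V, dy w z = E.hessYY z * u z - E.c z * v z - E.g z / 3 * w z

theorem RootODE.IsFrameOn.mono {E : RootODE} {V V' : Set (ℝ × ℝ)} {u v w : ℝ × ℝ → ℝ}
    (h : E.IsFrameOn V u v w) (hV : V' ⊆ V) : E.IsFrameOn V' u v w :=
  ⟨⟨h.smooth.1.mono hV, h.smooth.2.1.mono hV, h.smooth.2.2.mono hV⟩,
    fun z hz => h.dx_u z (hV hz), fun z hz => h.dy_u z (hV hz), fun z hz => h.dx_v z (hV hz),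
    fun z hz => h.dy_v z (hV hz), fun z hz => h.dx_w z (hV hz), fun z hz => h.dy_w z (hV hz)⟩

/-- The system is ∇²u = -Ric u for the trace-free connection a = h/3, b = -g/3, e = -h/3, f = g/3.
With `hessXX`, `hessXY`, `hessYY` equal to the components of -Ric, the u_x and u_y terms of the
integrability conditions cancel identically, and the u terms are, up to the factors ∓1/3, the two
Lie–Tresse expressions. -/
theorem RootODE.exists_isFrameOn {U : Set (ℝ × ℝ)} (hU : IsOpen U) {E : RootODE}
    (hE : E.SmoothOn U) (hLT : LieTresse U E) {z₀ : ℝ × ℝ} (hz₀ : z₀ ∈ U) (s₀ : ℝ × ℝ × ℝ) :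
    ∃ (V : Set (ℝ × ℝ)) (u v w : ℝ × ℝ → ℝ), IsOpen V ∧ z₀ ∈ V ∧ V ⊆ U ∧
      E.IsFrameOn V u v w ∧ (u z₀ = s₀.1 ∧ v z₀ = s₀.2.1 ∧ w z₀ = s₀.2.2) := by
  obtain ⟨hc, hg, hh, hd⟩ := hE
  have hcx := contDiffOn_dx hU hc
  have hgx := contDiffOn_dx hU hg
  have hgy := contDiffOn_dy hU hg
  have hhx := contDiffOn_dx hU hh
  have hhy := contDiffOn_dy hU hh
  have hdy := contDiffOn_dy hU hd
  have hXX : ContDiffOn ℝ ∞ E.hessXX U :=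
    (((hhx.div_const 3).add ((contDiffOn_const.mul (hh.pow 2)).div_const 9)).add hdy).sub
      ((contDiffOn_const.mul (hd.mul hg)).div_const 3)
  have hXY : ContDiffOn ℝ ∞ E.hessXY U :=
    ((hc.mul hd).sub ((hg.mul hh).div_const 9)).sub ((hhy.add hgx).div_const 3)
  have hYY : ContDiffOn ℝ ∞ E.hessYY U :=
    (((hgy.div_const 3).add ((contDiffOn_const.mul (hg.pow 2)).div_const 9)).add hcx).sub
      ((contDiffOn_const.mul (hc.mul hh)).div_const 3)
  have XXy : ∀ z ∈ U, dy E.hessXX z = dy (dx E.h) z / 3 + 4 * E.h z * dy E.h z / 9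
      + dy (dy E.d) z - 2 * dy (fun w => E.d w * E.g w) z / 3 := fun z hz => by
    rw [dy_mul hU hd hg hz]
    refine (((((hasDerivAt_dy hU hhx hz).div_const 3).add
      ((((hasDerivAt_dy hU hh hz).fun_pow 2).const_mul 2).div_const 9)).add
      (hasDerivAt_dy hU hdy hz)).sub ((((hasDerivAt_dy hU hd hz).fun_mul
      (hasDerivAt_dy hU hg hz)).const_mul 2).div_const 3)).deriv.trans ?_
    push_cast; ring
  have XYx : ∀ z ∈ U, dx E.hessXY z = dx E.c z * E.d z + E.c z * dx E.d z
      - (dx E.g z * E.h z + E.g z * dx E.h z) / 9 - (dy (dx E.h) z + dx (dx E.g) z) / 3 :=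
    fun z hz => by
    rw [← dx_dy_comm hU hh hz]
    exact ((((hasDerivAt_dx hU hc hz).fun_mul (hasDerivAt_dx hU hd hz)).sub
      (((hasDerivAt_dx hU hg hz).fun_mul (hasDerivAt_dx hU hh hz)).div_const 9)).sub
      (((hasDerivAt_dx hU hhy hz).fun_add (hasDerivAt_dx hU hgx hz)).div_const 3)).deriv
  have XYy : ∀ z ∈ U, dy E.hessXY z = dy E.c z * E.d z + E.c z * dy E.d z
      - (dy E.g z * E.h z + E.g z * dy E.h z) / 9 - (dy (dy E.h) z + dy (dx E.g) z) / 3 :=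
    fun z hz => ((((hasDerivAt_dy hU hc hz).fun_mul (hasDerivAt_dy hU hd hz)).sub
      (((hasDerivAt_dy hU hg hz).fun_mul (hasDerivAt_dy hU hh hz)).div_const 9)).sub
      (((hasDerivAt_dy hU hhy hz).fun_add (hasDerivAt_dy hU hgx hz)).div_const 3)).deriv
  have YYx : ∀ z ∈ U, dx E.hessYY z = dy (dx E.g) z / 3 + 4 * E.g z * dx E.g z / 9
      + dx (dx E.c) z - 2 * dx (fun w => E.c w * E.h w) z / 3 := fun z hz => by
    rw [dx_mul hU hc hh hz, ← dx_dy_comm hU hg hz]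
    refine (((((hasDerivAt_dx hU hgy hz).div_const 3).add
      ((((hasDerivAt_dx hU hg hz).fun_pow 2).const_mul 2).div_const 9)).add
      (hasDerivAt_dx hU hcx hz)).sub ((((hasDerivAt_dx hU hc hz).fun_mul
      (hasDerivAt_dx hU hh hz)).const_mul 2).div_const 3)).deriv.trans ?_
    push_cast; ring
  have neg : ∀ {k : ℝ × ℝ → ℝ}, ContDiffOn ℝ ∞ k U → ∀ (r : ℝ), ∀ z ∈ U,
      dx (fun z => r * k z) z = r * dx k z ∧ dy (fun z => r * k z) z = r * dy k z :=
    fun hk r z hz => ⟨dx_const_mul hU hk r hz, dy_const_mul hU hk r hz⟩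
  have sm : ∀ {k : ℝ × ℝ → ℝ}, ContDiffOn ℝ ∞ k U → ∀ (r : ℝ),
      ContDiffOn ℝ ∞ (fun z => r * k z) U := fun hk r => contDiffOn_const.mul hk
  obtain ⟨V, u, v, w, hVo, hzV, hVU, hsm, h0, hsys⟩ := exists_hessian_system_solution hU
    (α₁ := E.hessXX) (α₂ := fun z => -(1 / 3) * E.h z) (α₃ := fun z => -1 * E.d z)
    (β₁ := E.hessXY) (β₂ := fun z => 1 / 3 * E.g z) (β₃ := fun z => 1 / 3 * E.h z)
    (γ₁ := E.hessYY) (γ₂ := fun z => -1 * E.c z) (γ₃ := fun z => -(1 / 3) * E.g z)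
    hXX (sm hh _) (sm hd _) hXY (sm hg _) (sm hh _) hYY (sm hc _) (sm hg _)
    (by
      intro z hz u v w
      have hl := (hLT z hz).2
      rw [dy_mul hU hd hg hz] at hl
      rw [(neg hh _ z hz).2, (neg hd _ z hz).2, (neg hg _ z hz).1, (neg hh _ z hz).1, XXy z hz,
        XYx z hz, dy_mul hU hd hg hz]
      simp only [RootODE.hessXX, RootODE.hessXY, RootODE.hessYY]
      linear_combination -u / 3 * hl)
    (by
      intro z hz u v w
      have hl := (hLT z hz).1
      rw [dx_mul hU hc hh hz] at hl
      rw [(neg hg _ z hz).2, (neg hh _ z hz).2, (neg hc _ z hz).1, (neg hg _ z hz).1, XYy z hz,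
        YYx z hz, dx_mul hU hc hh hz]
      simp only [RootODE.hessXX, RootODE.hessXY, RootODE.hessYY]
      linear_combination u / 3 * hl) hz₀ s₀
  refine ⟨V, u, v, w, hVo, hzV, hVU, ⟨hsm, fun z hz => (hsys z hz).1, fun z hz => (hsys z hz).2.1,
    fun z hz => ?_, fun z hz => ?_, fun z hz => ?_, fun z hz => ?_⟩, h0⟩
  · rw [(hsys z hz).2.2.1]; ring
  · rw [(hsys z hz).2.2.2.1]; ring
  · rw [(hsys z hz).2.2.2.2.1]; ring
  · rw [(hsys z hz).2.2.2.2.2]; ring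

/-! ### Affine coordinates and the flat metric -/

section Connection

variable {V : Set (ℝ × ℝ)} {E : RootODE} {u v w : ℝ × ℝ → ℝ}

theorem dx_div (hV : IsOpen V) {f g : ℝ × ℝ → ℝ} (hf : ContDiffOn ℝ ∞ f V)
    (hg : ContDiffOn ℝ ∞ g V) {z : ℝ × ℝ} (hz : z ∈ V) (h0 : g z ≠ 0) :
    dx (fun w => f w / g w) z = (dx f z * g z - f z * dx g z) / g z ^ 2 :=
  ((hasDerivAt_dx hV hf hz).fun_div (hasDerivAt_dx hV hg hz) h0).deriv

theorem dy_div (hV : IsOpen V) {f g : ℝ × ℝ → ℝ} (hf : ContDiffOn ℝ ∞ f V)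
    (hg : ContDiffOn ℝ ∞ g V) {z : ℝ × ℝ} (hz : z ∈ V) (h0 : g z ≠ 0) :
    dy (fun w => f w / g w) z = (dy f z * g z - f z * dy g z) / g z ^ 2 :=
  ((hasDerivAt_dy hV hf hz).fun_div (hasDerivAt_dy hV hg hz) h0).deriv

/-- `X` is an affine coordinate for the connection with Christoffel symbols
`Γ¹₁₁ = -a, Γ¹₁₂ = -b, Γ¹₂₂ = -c, Γ²₁₁ = -d, Γ²₁₂ = -e, Γ²₂₂ = -f`. -/
structure IsAffineCoordinate (V : Set (ℝ × ℝ)) (a b c d e f X : ℝ × ℝ → ℝ) : Prop where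
  smooth : ContDiffOn ℝ ∞ X V
  dx_dx : ∀ z ∈ V, dx (dx X) z = -(a z * dx X z + d z * dy X z)
  dy_dx : ∀ z ∈ V, dy (dx X) z = -(b z * dx X z + e z * dy X z)
  dy_dy : ∀ z ∈ V, dy (dy X) z = -(c z * dx X z + f z * dy X z)

/-- The coefficient `a` of the flat connection determined by a solution `u`, `v = u_x`. -/
def RootODE.connA (E : RootODE) (u v : ℝ × ℝ → ℝ) (z : ℝ × ℝ) : ℝ := E.h z / 3 + 2 * (v z / u z)

/-- The coefficient `b` of the flat connection determined by a solution `u`, `w = u_y`. -/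
def RootODE.connB (E : RootODE) (u w : ℝ × ℝ → ℝ) (z : ℝ × ℝ) : ℝ := w z / u z - E.g z / 3

/-- The coefficient `e` of the flat connection determined by a solution `u`, `v = u_x`. -/
def RootODE.connE (E : RootODE) (u v : ℝ × ℝ → ℝ) (z : ℝ × ℝ) : ℝ := v z / u z - E.h z / 3

/-- The coefficient `f` of the flat connection determined by a solution `u`, `w = u_y`. -/
def RootODE.connF (E : RootODE) (u w : ℝ × ℝ → ℝ) (z : ℝ × ℝ) : ℝ := E.g z / 3 + 2 * (w z / u z)

theorem RootODE.IsFrameOn.contDiffOn_conn (hE : E.SmoothOn V) (hu : E.IsFrameOn V u v w)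
    (hu0 : ∀ z ∈ V, u z ≠ 0) :
    ContDiffOn ℝ ∞ (E.connA u v) V ∧ ContDiffOn ℝ ∞ (E.connB u w) V ∧
      ContDiffOn ℝ ∞ (E.connE u v) V ∧ ContDiffOn ℝ ∞ (E.connF u w) V := by
  obtain ⟨-, hg, hh, -⟩ := hE
  obtain ⟨su, sv, sw⟩ := hu.smooth
  exact ⟨(hh.div_const 3).add (contDiffOn_const.mul (sv.div su hu0)),
    (sw.div su hu0).sub (hg.div_const 3), (sv.div su hu0).sub (hh.div_const 3),
    (hg.div_const 3).add (contDiffOn_const.mul (sw.div su hu0))⟩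

/-- The connection is the trace-free one changed projectively by d log u, and the second-order
equations for u are what makes its curvature vanish. -/
theorem RootODE.IsFrameOn.flat (hV : IsOpen V) (hE : E.SmoothOn V) (hu : E.IsFrameOn V u v w)
    (hu0 : ∀ z ∈ V, u z ≠ 0) :
    Flat V (E.connA u v) (E.connB u w) E.c E.d (E.connE u v) (E.connF u w) := by
  intro z hz
  obtain ⟨-, hg, hh, -⟩ := hE
  obtain ⟨su, sv, sw⟩ := hu.smooth
  have u0 := hu0 z hz
  have vx := (hasDerivAt_dx hV sv hz).fun_div (hasDerivAt_dx hV su hz) u0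
  have vy := (hasDerivAt_dy hV sv hz).fun_div (hasDerivAt_dy hV su hz) u0
  have wx := (hasDerivAt_dx hV sw hz).fun_div (hasDerivAt_dx hV su hz) u0
  have wy := (hasDerivAt_dy hV sw hz).fun_div (hasDerivAt_dy hV su hz) u0
  have gx := (hasDerivAt_dx hV hg hz).div_const 3
  have gy := (hasDerivAt_dy hV hg hz).div_const 3
  have hx := (hasDerivAt_dx hV hh hz).div_const 3
  have hy := (hasDerivAt_dy hV hh hz).div_const 3
  have ay : dy (E.connA u v) z = _ := (hy.fun_add (vy.const_mul 2)).deriv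
  have bx : dx (E.connB u w) z = _ := (wx.fun_sub gx).deriv
  have byy : dy (E.connB u w) z = _ := (wy.fun_sub gy).deriv
  have ex : dx (E.connE u v) z = _ := (vx.fun_sub hx).deriv
  have bfx : dx (fun z => E.connB u w z + E.connF u w z) z = _ :=
    ((wx.fun_sub gx).fun_add (gx.fun_add (wx.const_mul 2))).deriv
  have aey : dy (fun z => E.connA u v z + E.connE u v z) z = _ :=
    ((hy.fun_add (vy.const_mul 2)).fun_add (vy.fun_sub hy)).deriv
  rw [ay, bx, byy, ex, bfx, aey]
  simp only [Prod.mk.eta]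
  rw [hu.dx_u z hz, hu.dy_u z hz, hu.dx_v z hz, hu.dy_v z hz, hu.dx_w z hz, hu.dy_w z hz]
  simp only [RootODE.connA, RootODE.connB, RootODE.connE, RootODE.connF, RootODE.hessXX,
    RootODE.hessXY, RootODE.hessYY]
  refine ⟨?_, ?_, ?_, ?_⟩
  all_goals
    field_simp
    ring

/-- Numerator and denominator solve the same linear system, so the terms of order zero cancel in the
Hessian of the quotient. The first-order terms from differentiating 1/u produce the shifts by v/u
and w/u in the connection. -/
theorem RootODE.IsFrameOn.isAffineCoordinate_div (hV : IsOpen V) (hu : E.IsFrameOn V u v w)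
    (hu0 : ∀ z ∈ V, u z ≠ 0) {u₁ v₁ w₁ : ℝ × ℝ → ℝ} (hu₁ : E.IsFrameOn V u₁ v₁ w₁) :
    IsAffineCoordinate V (E.connA u v) (E.connB u w) E.c E.d (E.connE u v) (E.connF u w)
      (fun z => u₁ z / u z) := by
  obtain ⟨su, sv, sw⟩ := hu.smooth
  obtain ⟨su₁, sv₁, sw₁⟩ := hu₁.smooth
  have hX : ∀ z ∈ V, dx (fun z => u₁ z / u z) z = (v₁ z * u z - u₁ z * v z) / u z ^ 2 :=
    fun z hz => by rw [dx_div hV su₁ su hz (hu0 z hz), hu.dx_u z hz, hu₁.dx_u z hz]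
  have hY : ∀ z ∈ V, dy (fun z => u₁ z / u z) z = (w₁ z * u z - u₁ z * w z) / u z ^ 2 :=
    fun z hz => by rw [dy_div hV su₁ su hz (hu0 z hz), hu.dy_u z hz, hu₁.dy_u z hz]
  have ne : ∀ z ∈ V, u z ^ 2 ≠ 0 := fun z hz => pow_ne_zero 2 (hu0 z hz)
  refine ⟨su₁.div su hu0, fun z hz => ?_, fun z hz => ?_, fun z hz => ?_⟩
  · rw [dx_congr hV hX hz, hX z hz, hY z hz]
    refine ((((hasDerivAt_dx hV sv₁ hz).fun_mul (hasDerivAt_dx hV su hz)).fun_sub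
      ((hasDerivAt_dx hV su₁ hz).fun_mul (hasDerivAt_dx hV sv hz))).fun_div
      ((hasDerivAt_dx hV su hz).fun_pow 2) (ne z hz)).deriv.trans ?_
    simp only [Prod.mk.eta]
    rw [hu.dx_u z hz, hu.dx_v z hz, hu₁.dx_u z hz, hu₁.dx_v z hz]
    have := hu0 z hz
    simp only [RootODE.connA]
    field_simp
    ring
  · rw [dy_congr hV hX hz, hX z hz, hY z hz]
    refine ((((hasDerivAt_dy hV sv₁ hz).fun_mul (hasDerivAt_dy hV su hz)).fun_sub
      ((hasDerivAt_dy hV su₁ hz).fun_mul (hasDerivAt_dy hV sv hz))).fun_div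
      ((hasDerivAt_dy hV su hz).fun_pow 2) (ne z hz)).deriv.trans ?_
    simp only [Prod.mk.eta]
    rw [hu.dy_u z hz, hu.dy_v z hz, hu₁.dy_u z hz, hu₁.dy_v z hz]
    have := hu0 z hz
    simp only [RootODE.connB, RootODE.connE]
    field_simp
    ring
  · rw [dy_congr hV hY hz, hX z hz, hY z hz]
    refine ((((hasDerivAt_dy hV sw₁ hz).fun_mul (hasDerivAt_dy hV su hz)).fun_sub
      ((hasDerivAt_dy hV su₁ hz).fun_mul (hasDerivAt_dy hV sw hz))).fun_div
      ((hasDerivAt_dy hV su hz).fun_pow 2) (ne z hz)).deriv.trans ?_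
    simp only [Prod.mk.eta]
    rw [hu.dy_u z hz, hu.dy_w z hz, hu₁.dy_u z hz, hu₁.dy_w z hz]
    have := hu0 z hz
    simp only [RootODE.connF]
    field_simp
    ring

variable {a b c d e f X Y : ℝ × ℝ → ℝ}

/-- The connection is the Levi-Civita connection of `dX² + dY²`. -/
theorem IsAffineCoordinate.metricCompatible (hV : IsOpen V)
    (hX : IsAffineCoordinate V a b c d e f X) (hY : IsAffineCoordinate V a b c d e f Y)
    (hJ : ∀ z ∈ V, dx X z * dy Y z - dy X z * dx Y z ≠ 0) :
    MetricCompatible V a b c d e f (fun z => dx X z ^ 2 + dx Y z ^ 2)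
      (fun z => dx X z * dy X z + dx Y z * dy Y z) (fun z => dy X z ^ 2 + dy Y z ^ 2) := by
  have sXx := contDiffOn_dx hV hX.smooth
  have sXy := contDiffOn_dy hV hX.smooth
  have sYx := contDiffOn_dx hV hY.smooth
  have sYy := contDiffOn_dy hV hY.smooth
  intro z hz
  have x1 := hasDerivAt_dx hV sXx hz
  have x2 := hasDerivAt_dx hV sXy hz
  have x3 := hasDerivAt_dx hV sYx hz
  have x4 := hasDerivAt_dx hV sYy hz
  have y1 := hasDerivAt_dy hV sXx hz
  have y2 := hasDerivAt_dy hV sXy hz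
  have y3 := hasDerivAt_dy hV sYx hz
  have y4 := hasDerivAt_dy hV sYy hz
  rw [hX.dx_dx z hz] at x1
  rw [dx_dy_comm hV hX.smooth hz, hX.dy_dx z hz] at x2
  rw [hY.dx_dx z hz] at x3
  rw [dx_dy_comm hV hY.smooth hz, hY.dy_dx z hz] at x4
  rw [hX.dy_dx z hz] at y1
  rw [hX.dy_dy z hz] at y2
  rw [hY.dy_dx z hz] at y3
  rw [hY.dy_dy z hz] at y4
  refine ⟨?_, ?_, ?_, ?_, ?_, ?_, ?_⟩
  · have : (dx X z ^ 2 + dx Y z ^ 2) * (dy X z ^ 2 + dy Y z ^ 2) -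
        (dx X z * dy X z + dx Y z * dy Y z) ^ 2 = (dx X z * dy Y z - dy X z * dx Y z) ^ 2 := by ring
    rw [this]
    exact pow_ne_zero 2 (hJ z hz)
  · exact ((x1.fun_pow 2).fun_add (x3.fun_pow 2)).deriv.trans (by push_cast; ring)
  · exact ((x1.fun_mul x2).fun_add (x3.fun_mul x4)).deriv.trans (by simp only [Prod.mk.eta]; ring)
  · exact ((x2.fun_pow 2).fun_add (x4.fun_pow 2)).deriv.trans (by push_cast; ring)
  · exact ((y1.fun_pow 2).fun_add (y3.fun_pow 2)).deriv.trans (by push_cast; ring)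
  · exact ((y1.fun_mul y2).fun_add (y3.fun_mul y4)).deriv.trans (by simp only [Prod.mk.eta]; ring)
  · exact ((y2.fun_pow 2).fun_add (y4.fun_pow 2)).deriv.trans (by push_cast; ring)

/-- In affine coordinates the unparametrized geodesics, which are the solutions of the root
equation, are the straight lines. -/
theorem IsAffineCoordinate.lhs_eq_zero_iff (hV : IsOpen V)
    (hX : IsAffineCoordinate V a b E.c E.d e f X) (hY : IsAffineCoordinate V a b E.c E.d e f Y)
    (hJ : ∀ z ∈ V, dx X z * dy Y z - dy X z * dx Y z ≠ 0)
    (hh : ∀ z ∈ V, E.h z = a z - 2 * e z ∧ E.g z = f z - 2 * b z)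
    {y : ℝ → ℝ} (hy : ContDiff ℝ ∞ y) {x : ℝ} (hz : (x, y x) ∈ V)
    (hX0 : deriv (fun s => X (s, y s)) x ≠ 0) :
    E.lhs y x = 0 ↔ transformedSecondDeriv X Y y x = 0 := by
  have hy2 : ContDiffOn ℝ (2 : ℕ) y Set.univ := (hy.of_le (natCast_le_infty 2)).contDiffOn
  have h0 : ∀ t, HasDerivAt y (deriv y t) t := fun t => by
    simpa using hasDerivAt_iteratedDeriv (k := 0) isOpen_univ hy2 (by norm_num) (Set.mem_univ t)
  have h1 : HasDerivAt (deriv y) (iteratedDeriv 2 y x) x := by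
    simpa using hasDerivAt_iteratedDeriv (k := 1) isOpen_univ hy2 (by norm_num) (Set.mem_univ x)
  have hev : ∀ᶠ t in nhds x, (t, y t) ∈ V :=
    (continuousAt_id.prodMk hy.continuous.continuousAt).eventually (hV.mem_nhds hz)
  have dX : ∀ t, (t, y t) ∈ V → deriv (fun s => X (s, y s)) t =
      dx X (t, y t) + dy X (t, y t) * deriv y t := fun t ht =>
    (hasDerivAt_along hV hX.smooth (h0 t) ht).deriv
  have dY : ∀ t, (t, y t) ∈ V → deriv (fun s => Y (s, y s)) t =
      dx Y (t, y t) + dy Y (t, y t) * deriv y t := fun t ht =>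
    (hasDerivAt_along hV hY.smooth (h0 t) ht).deriv
  rw [dX x hz] at hX0
  have hquot : (fun t => deriv (fun s => Y (s, y s)) t / deriv (fun s => X (s, y s)) t)
      =ᶠ[nhds x] fun t => (dx Y (t, y t) + dy Y (t, y t) * deriv y t) /
        (dx X (t, y t) + dy X (t, y t) * deriv y t) := by
    filter_upwards [hev] with t ht
    rw [dX t ht, dY t ht]
  have hq := ((hasDerivAt_along_total hV hY.smooth (h0 x) h1 hz).fun_div
    (hasDerivAt_along_total hV hX.smooth (h0 x) h1 hz) hX0).deriv
  -- With J the Jacobian, d²Y/dX² = J · (left side of (E)) / (dX/dx)³, and neither J nor dX/dx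
  -- vanishes.
  have key : transformedSecondDeriv X Y y x =
      (dx X (x, y x) * dy Y (x, y x) - dy X (x, y x) * dx Y (x, y x)) * E.lhs y x /
        (dx X (x, y x) + dy X (x, y x) * deriv y x) ^ 3 := by
    rw [transformedSecondDeriv, hquot.deriv_eq, dX x hz, hq, hX.dx_dx _ hz, hX.dy_dx _ hz,
      hX.dy_dy _ hz, hY.dx_dx _ hz, hY.dy_dx _ hz, hY.dy_dy _ hz, RootODE.lhs, (hh _ hz).1,
      (hh _ hz).2]
    field_simp
    ring
  rw [key, div_eq_zero_iff, mul_eq_zero]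
  simp [hJ _ hz, hX0]

end Connection

/-- A pair of smooth functions whose differentials at a point are `dx` and `dy` is injective near
that point. -/
theorem exists_injOn_of_partials {V : Set (ℝ × ℝ)} (hV : IsOpen V) {X Y : ℝ × ℝ → ℝ}
    (hX : ContDiffOn ℝ ∞ X V) (hY : ContDiffOn ℝ ∞ Y V) {z₀ : ℝ × ℝ} (hz₀ : z₀ ∈ V)
    (h₁ : dx X z₀ = 1) (h₂ : dy X z₀ = 0) (h₃ : dx Y z₀ = 0) (h₄ : dy Y z₀ = 1) :
    ∃ V' : Set (ℝ × ℝ), IsOpen V' ∧ z₀ ∈ V' ∧ Set.InjOn (fun z => (X z, Y z)) V' := by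
  have strict : ∀ {f : ℝ × ℝ → ℝ}, ContDiffOn ℝ ∞ f V → HasStrictFDerivAt f (fderiv ℝ f z₀) z₀ :=
    fun hf => (hf.contDiffAt (hV.mem_nhds hz₀)).hasStrictFDerivAt (by simp)
  have h : HasStrictFDerivAt (fun z => (X z, Y z))
      (ContinuousLinearEquiv.refl ℝ (ℝ × ℝ) : (ℝ × ℝ) →L[ℝ] (ℝ × ℝ)) z₀ := by
    refine ((strict hX).prodMk (strict hY)).congr_fderiv ?_
    rw [dx_eq_fderiv hV hX hz₀] at h₁
    rw [dy_eq_fderiv hV hX hz₀] at h₂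
    rw [dx_eq_fderiv hV hY hz₀] at h₃
    rw [dy_eq_fderiv hV hY hz₀] at h₄
    ext <;> simp [h₁, h₂, h₃, h₄]
  exact ⟨_, (h.toOpenPartialHomeomorph _).open_source, h.mem_toOpenPartialHomeomorph_source,
    (h.toOpenPartialHomeomorph _).injOn⟩

/-- A root equation that satisfies the Lie–Tresse criteria is, locally, the equation of the
unparametrized geodesics of a connection with a pair of independent affine coordinates. -/
theorem LieTresse.exists_affine_coordinates {U : Set (ℝ × ℝ)} (hU : IsOpen U) {E : RootODE}
    (hE : E.SmoothOn U) (hLT : LieTresse U E) {z₀ : ℝ × ℝ} (hz₀ : z₀ ∈ U) :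
    ∃ (V : Set (ℝ × ℝ)) (a b e f X Y : ℝ × ℝ → ℝ), IsOpen V ∧ z₀ ∈ V ∧ V ⊆ U ∧
      (ContDiffOn ℝ ∞ a V ∧ ContDiffOn ℝ ∞ b V ∧ ContDiffOn ℝ ∞ e V ∧ ContDiffOn ℝ ∞ f V) ∧
      (∀ z ∈ V, E.h z = a z - 2 * e z ∧ E.g z = f z - 2 * b z) ∧
      Flat V a b E.c E.d e f ∧
      IsAffineCoordinate V a b E.c E.d e f X ∧ IsAffineCoordinate V a b E.c E.d e f Y ∧
      Set.InjOn (fun z => (X z, Y z)) V ∧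
      ∀ z ∈ V, dx X z * dy Y z - dy X z * dx Y z ≠ 0 := by
  -- Initial data (u, u_x, u_y) run through the standard basis, so that u ≠ 0 near z₀ and the
  -- differentials of u₁/u and u₂/u at z₀ are dx and dy.
  obtain ⟨V₀, u, v, w, hV₀, hzV₀, hV₀U, hu, iu, iv, iw⟩ :=
    E.exists_isFrameOn hU hE hLT hz₀ (1, 0, 0)
  obtain ⟨V₁, u₁, v₁, w₁, hV₁, hzV₁, -, hu₁, iu₁, iv₁, iw₁⟩ :=
    E.exists_isFrameOn hU hE hLT hz₀ (0, 1, 0)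
  obtain ⟨V₂, u₂, v₂, w₂, hV₂, hzV₂, -, hu₂, iu₂, iv₂, iw₂⟩ :=
    E.exists_isFrameOn hU hE hLT hz₀ (0, 0, 1)
  simp only at iu iv iw iu₁ iv₁ iw₁ iu₂ iv₂ iw₂
  have hV₃ : IsOpen (V₀ ∩ V₁ ∩ V₂) := (hV₀.inter hV₁).inter hV₂
  obtain ⟨V, hV, hzV, hVsub, hV0⟩ : ∃ V : Set (ℝ × ℝ), IsOpen V ∧ z₀ ∈ V ∧ V ⊆ V₀ ∩ V₁ ∩ V₂ ∧
      ∀ z ∈ V, u z ≠ 0 := by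
    refine ⟨V₀ ∩ V₁ ∩ V₂ ∩ u ⁻¹' {0}ᶜ, ?_, ⟨⟨⟨hzV₀, hzV₁⟩, hzV₂⟩, by simp [iu]⟩,
      Set.inter_subset_left, fun z hz => hz.2⟩
    exact (hu.smooth.1.continuousOn.mono fun z hz => hz.1.1).isOpen_inter_preimage hV₃
      isOpen_compl_singleton
  have hVU : V ⊆ U := fun z hz => hV₀U (hVsub hz).1.1
  have fu := hu.mono fun z (hz : z ∈ V) => (hVsub hz).1.1
  have fu₁ := hu₁.mono fun z (hz : z ∈ V) => (hVsub hz).1.2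
  have fu₂ := hu₂.mono fun z (hz : z ∈ V) => (hVsub hz).2
  have hX := (fu.isAffineCoordinate_div hV hV0 fu₁).smooth
  have hY := (fu.isAffineCoordinate_div hV hV0 fu₂).smooth
  have u0 := hV0 z₀ hzV
  have jX : dx (fun z => u₁ z / u z) z₀ = 1 := by
    rw [dx_div hV fu₁.smooth.1 fu.smooth.1 hzV u0, fu₁.dx_u z₀ hzV, fu.dx_u z₀ hzV]
    simp [iu, iv, iu₁, iv₁]
  have jX' : dy (fun z => u₁ z / u z) z₀ = 0 := by
    rw [dy_div hV fu₁.smooth.1 fu.smooth.1 hzV u0, fu₁.dy_u z₀ hzV, fu.dy_u z₀ hzV]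
    simp [iu, iw, iu₁, iw₁]
  have jY : dx (fun z => u₂ z / u z) z₀ = 0 := by
    rw [dx_div hV fu₂.smooth.1 fu.smooth.1 hzV u0, fu₂.dx_u z₀ hzV, fu.dx_u z₀ hzV]
    simp [iu, iv, iu₂, iv₂]
  have jY' : dy (fun z => u₂ z / u z) z₀ = 1 := by
    rw [dy_div hV fu₂.smooth.1 fu.smooth.1 hzV u0, fu₂.dy_u z₀ hzV, fu.dy_u z₀ hzV]
    simp [iu, iw, iu₂, iw₂]
  obtain ⟨V', hV', hzV', hinj⟩ := exists_injOn_of_partials hV hX hY hzV jX jX' jY jY'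
  have hJc : ContinuousOn (fun z => dx (fun z => u₁ z / u z) z * dy (fun z => u₂ z / u z) z
      - dy (fun z => u₁ z / u z) z * dx (fun z => u₂ z / u z) z) V :=
    ((contDiffOn_dx hV hX).continuousOn.mul (contDiffOn_dy hV hY).continuousOn).sub
      ((contDiffOn_dy hV hX).continuousOn.mul (contDiffOn_dx hV hY).continuousOn)
  -- The neighbourhood is shrunk so that the Jacobian has no zero and the coordinates are injective.
  have hVJ := (hJc.isOpen_inter_preimage hV (isOpen_compl_singleton (x := (0 : ℝ)))).inter hV'
  refine ⟨_, E.connA u v, E.connB u w, E.connE u v, E.connF u w, fun z => u₁ z / u z,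
    fun z => u₂ z / u z, hVJ, ⟨⟨hzV, ?_⟩, hzV'⟩, fun z hz => hVU hz.1.1, ?_, ?_, ?_, ?_, ?_,
    hinj.mono fun z hz => hz.2, fun z hz => hz.1.2⟩
  · simp [jX, jX', jY, jY']
  all_goals
    generalize hV4 : (V ∩ _) ∩ V' = V₄ at hVJ ⊢
    have hsub : V₄ ⊆ V := by rw [← hV4]; exact fun z hz => hz.1.1
    have nz : ∀ z ∈ V₄, u z ≠ 0 := fun z hz => hV0 z (hsub hz)
    have sE : E.SmoothOn V₄ :=
      ⟨hE.1.mono (hsub.trans hVU), hE.2.1.mono (hsub.trans hVU),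
        hE.2.2.1.mono (hsub.trans hVU), hE.2.2.2.mono (hsub.trans hVU)⟩
  · exact (fu.mono hsub).contDiffOn_conn sE nz
  · intro z _
    simp only [RootODE.connA, RootODE.connB, RootODE.connE, RootODE.connF]
    constructor <;> ring
  · exact (fu.mono hsub).flat hVJ sE nz
  · exact (fu.mono hsub).isAffineCoordinate_div hVJ nz (fu₁.mono hsub)
  · exact (fu.mono hsub).isAffineCoordinate_div hVJ nz (fu₂.mono hsub)

theorem LieTresse.linearizable {U : Set (ℝ × ℝ)} (hU : IsOpen U) {E : RootODE}
    (hE : E.SmoothOn U) (hLT : LieTresse U E) : E.Linearizable U := by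
  intro z₀ hz₀
  obtain ⟨V, a, b, e, f, X, Y, hV, hz, hVU, -, hh, -, hX, hY, hinj, hJ⟩ :=
    hLT.exists_affine_coordinates hU hE hz₀
  exact ⟨V, X, Y, hV, hz, hVU, hX.smooth, hY.smooth, hinj, hJ,
    fun y hy x hx hx0 => hX.lhs_eq_zero_iff hV hY hJ hh hy hx hx0⟩

theorem LieTresse.metricConsistent {U : Set (ℝ × ℝ)} (hU : IsOpen U) {E : RootODE}
    (hE : E.SmoothOn U) (hLT : LieTresse U E) : MetricConsistent U E := by
  intro z₀ hz₀
  obtain ⟨V, a, b, e, f, X, Y, hV, hz, hVU, hsm, hh, hflat, hX, hY, -, hJ⟩ :=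
    hLT.exists_affine_coordinates hU hE hz₀
  have sXx := contDiffOn_dx hV hX.smooth
  have sXy := contDiffOn_dy hV hX.smooth
  have sYx := contDiffOn_dx hV hY.smooth
  have sYy := contDiffOn_dy hV hY.smooth
  exact ⟨V, a, b, e, f, _, _, _, hV, hz, hVU, hsm,
    ⟨(sXx.pow 2).add (sYx.pow 2), (sXx.mul sXy).add (sYx.mul sYy), (sXy.pow 2).add (sYy.pow 2)⟩,
    hh, hflat, hX.metricCompatible hV hY hJ⟩

end CondLin

end

/-! ### Assembly of the three claims -/

theorem theorem2 (U : Set (ℝ × ℝ)) (hU : IsOpen U)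
    (F : CondLin.QuadODE) (hF : F.SmoothOn U)
    (E : CondLin.RootODE) (hE : E.SmoothOn U) :
    (CondLin.ArisesFrom U F E ↔
      CondLin.Identification U F E ∧ CondLin.IntegralFormula U F E ∧
        CondLin.Constraints U F E) ∧
    (CondLin.Identification U F E → CondLin.IntegralFormula U F E →
      CondLin.Constraints U F E → CondLin.LieTresse U E →
        CondLin.ConditionallyLinearizable U F E ∧ CondLin.MetricConsistent U E) ∧
    ((∃ z ∈ U, F.Q1 z ≠ 0 ∨ F.Q0 z ≠ 0) → ¬ CondLin.IsTotalDerivative U F) := by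
  refine ⟨CondLin.arisesFrom_iff hU hF hE, fun hid hint hcon hLT => ⟨⟨fun I y hy => ?_,
    hLT.linearizable hU hE⟩, hLT.metricConsistent hU hE⟩, ?_⟩
  · exact hy.quadODE hU hE ((CondLin.coefficientRelations_iff hU hF hE).2 ⟨hid, hint, hcon⟩)
  · rintro ⟨z, hz, hne⟩ htot
    obtain ⟨h1, h0⟩ := htot.quadratic_term_eq_zero hU z hz
    exact hne.elim (fun h => h h1) (fun h => h h0)
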